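/- Let $N\ge 2$, $T>0$ and $\mu,\nu\ge 0$. A triple $(v,b,p)$ is called a weak solution of the magnetohydrodynamic equations $$\partial_t v+(v\cdot\nabla)v=(b\cdot\nabla)b-\nabla\big(p+\tfrac12|b|^2\big)+\nu\Delta v,\qquad \partial_t b+(v\cdot\nabla)b=(b\cdot\nabla)v+\mu\Delta b,\qquad \operatorname{div}v=\operatorname{div}b=0$$ on $\mathbb R^N\times(0,T)$ if $v,b\in L^1(0,T;L^2_\sigma(\mathbb R^N))$ (the $L^2$ vector fields whose distributional divergence is $0$), $p\in L^1(0,T;\mathcal S'(\mathbb R^N))$ (that is, $t\mapsto\langle p(t),\psi\rangle$ is integrable on $(0,T)$ for every Schwartz function $\psi$), and for all $\phi\in[C_c^\infty(\mathbb R^N)]^N$ and $\xi\in C_c^1(0,T)$ the integrals below exist (each integral over space existing for a.e. $t$ and, multiplied by $\xi$ or $\xi'$, being integrable in $t$) and $$-\int_0^T\!\!\int v\cdot\phi\,\xi'\,dx\,dt-\int_0^T\!\!\int v\otimes v:\nabla\phi\,\xi\,dx\,dt=-\int_0^T\!\!\int b\otimes b:\nabla\phi\,\xi\,dx\,dt+\int_0^T\langle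 p(t),\operatorname{div}\phi\rangle\,\xi\,dt+\frac12\int_0^T\!\!\int|b|^2\operatorname{div}\phi\,\xi\,dx\,dt+\nu\int_0^T\!\!\int v\cdot\Delta\phi\,\xi\,dx\,dt,$$ $$-\int_0^T\!\!\int b\cdot\phi\,\xi'\,dx\,dt-\int_0^T\!\!\int v\otimes b:\nabla\phi\,\xi\,dx\,dt=-\int_0^T\!\!\int b\otimes v:\nabla\phi\,\xi\,dx\,dt+\mu\int_0^T\!\!\int b\cdot\Delta\phi\,\xi\,dx\,dt,$$ where $(a\otimes c)_{ij}=a_ic_j$, $(\nabla\phi)_{ij}=\partial_i\phi^j$ and $A:B=\sum_{i,j}A_{ij}B_{ij}$. Fix a Schwartz function $\eta$ on $\mathbb R^N$ with $\int\eta\,dx\ne0$, put $\eta_s(x)=s^{-N}\eta(x/s)$, and for $0<q\le1$ let $\mathcal H^q(\mathbb R^N)$ be the Hardy space of all $f\in\mathcal S'(\mathbb R^N)$ with $\|f\|_{\mathcal H^q}:=\big\|\sup_{s>0}|f*\eta_s|\big\|_{L^q}<\infty$. Let $(v,b,p)$ be a weak solution of the magnetohydrodynamic equations on $\mathbb R^N\times(0,T)$,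 and suppose that either $p\in L^1(0,T;L^1(\mathbb R^N))$ and $\int_{\mathbb R^N}p(x,t)\,dx\ge0$ for a.e. $t\in(0,T)$, or $p\in L^1(0,T;\mathcal H^q(\mathbb R^N))$ for some $q\in(0,1]$. If $N\ge3$, then $v=b=0$ a.e. in $\mathbb R^N\times(0,T)$. If $N=2$, then $v=0$ a.e. in $\mathbb R^2\times(0,T)$, $\int_{\mathbb R^2}(b^1(x,t))^2dx=\int_{\mathbb R^2}(b^2(x,t))^2dx$ for a.e. $t\in(0,T)$, and $b$ is a weak solution of the heat equation $\partial_tb=\mu\Delta b$, that is, $$-\int_0^T\!\!\int_{\mathbb R^2} b\cdot\phi\,\xi'\,dx\,dt=\mu\int_0^T\!\!\int_{\mathbb R^2} b\cdot\Delta\phi\,\xi\,dx\,dt\qquad\text{for all }\phi\in[C_c^\infty(\mathbb R^2)]^2,\ \xi\in C_c^1(0,T).$$ -/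

import Mathlib

open MeasureTheory Set
open scoped SchwartzMap ENNReal ContDiff

noncomputable section

namespace MHD

/-- The Euclidean space `ℝ^N`. -/
abbrev Sp (N : ℕ) : Type := EuclideanSpace ℝ (Fin N)

/-- Real tempered distributions on `ℝ^N`. -/
abbrev Distr (N : ℕ) : Type := 𝓢(Sp N, ℝ) →L[ℝ] ℝ

variable {N : ℕ}

/-! ### Test functions and differential operators -/

/-- Vector test functions: `φ ∈ [C_c^∞(ℝ^N)]^N`. -/
structure IsSpaceTest (φ : Sp N → Sp N) : Prop where
  contDiff : ContDiff ℝ ∞ φ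
  compact : HasCompactSupport φ

/-- Test functions in time: `ξ ∈ C_c^1(0,T)`. -/
structure IsTimeTest (T : ℝ) (ξ : ℝ → ℝ) : Prop where
  contDiff : ContDiff ℝ 1 ξ
  compact : HasCompactSupport ξ
  supp : tsupport ξ ⊆ Ioo 0 T

/-- The matrix entry `(∇φ)_{ij} = ∂_i φ^j`. -/
def pd (i j : Fin N) (φ : Sp N → Sp N) (x : Sp N) : ℝ :=
  (fderiv ℝ φ x (EuclideanSpace.single i 1)) j

/-- The divergence `div φ = ∑_i ∂_i φ^i`. -/
def divg (φ : Sp N → Sp N) (x : Sp N) : ℝ := ∑ i, pd i i φ x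

theorem contDiff_divg {φ : Sp N → Sp N} (hφ : IsSpaceTest φ) : ContDiff ℝ ∞ (divg φ) := by
  have h1 : ContDiff ℝ ∞ (fderiv ℝ φ) := hφ.contDiff.fderiv_right (by simp)
  refine ContDiff.sum fun i _ => ?_
  have h2 : ContDiff ℝ ∞ (fun x => fderiv ℝ φ x (EuclideanSpace.single i 1)) :=
    h1.clm_apply contDiff_const
  exact (EuclideanSpace.proj (𝕜 := ℝ) i : Sp N →L[ℝ] ℝ).contDiff.comp h2

theorem hasCompactSupport_divg {φ : Sp N → Sp N} (hφ : IsSpaceTest φ) :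
    HasCompactSupport (divg φ) := by
  refine (hφ.compact.fderiv (𝕜 := ℝ)).mono ?_
  intro x hx h0
  apply hx
  simp [divg, pd, h0]

/-- `div φ` as a Schwartz function, so that it can be paired with a tempered distribution. -/
def divS {φ : Sp N → Sp N} (hφ : IsSpaceTest φ) : 𝓢(Sp N, ℝ) :=
  (hasCompactSupport_divg hφ).toSchwartzMap (contDiff_divg hφ)

/-! ### Function spaces -/

/-- `u ∈ L^1(0,T; L^2_σ(ℝ^N))`; the divergence vanishes in the sense of distributions. -/
structure MemL1L2σ (T : ℝ) (u : ℝ → Sp N → Sp N) : Prop where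
  meas : AEStronglyMeasurable (Function.uncurry u)
    ((volume.restrict (Ioo 0 T)).prod volume)
  memL2 : ∀ᵐ t ∂(volume.restrict (Ioo 0 T)), MemLp (u t) 2 volume
  normL1 : ∫⁻ t in Ioo 0 T, eLpNorm (u t) 2 volume < ⊤
  div_free : ∀ᵐ t ∂(volume.restrict (Ioo 0 T)), ∀ ψ : Sp N → ℝ, ContDiff ℝ ∞ ψ →
    HasCompactSupport ψ → ∫ x, inner ℝ (u t x) (gradient ψ x) = 0

/-- `p ∈ L^1(0,T; 𝓢')`: every pairing `t ↦ ⟨p(t), ψ⟩` is integrable on `(0,T)`. -/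
def MemL1Distr (T : ℝ) (p : ℝ → Distr N) : Prop :=
  ∀ ψ : 𝓢(Sp N, ℝ), IntegrableOn (fun t => p t ψ) (Ioo 0 T)

/-- `p ∈ L^1(0,T; L^1(ℝ^N))` with `∫ p(x,t) dx ≥ 0` for a.e. `t ∈ (0,T)`: for a.e. `t` the
distribution `p(t)` is given by an integrable function `g(t)`. -/
def MemL1L1Plus (T : ℝ) (p : ℝ → Distr N) : Prop :=
  ∃ g : ℝ → Sp N → ℝ,
    Integrable (Function.uncurry g) ((volume.restrict (Ioo 0 T)).prod volume) ∧
    (∀ᵐ t ∂(volume.restrict (Ioo 0 T)), ∀ ψ : 𝓢(Sp N, ℝ), p t ψ = ∫ x, g t x * ψ x) ∧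
    ∀ᵐ t ∂(volume.restrict (Ioo 0 T)), 0 ≤ ∫ x, g t x

/-- The Schwartz function `y ↦ η_s(x - y)`, where `η_s(z) = s^{-N} η(z / s)` and `s > 0`. -/
def kernelS (η : 𝓢(Sp N, ℝ)) (s : ℝ) (hs : 0 < s) (x : Sp N) : 𝓢(Sp N, ℝ) :=
  (s ^ N)⁻¹ • SchwartzMap.compSubConstCLM ℝ x
    (SchwartzMap.compCLMOfContinuousLinearEquiv ℝ
      (ContinuousLinearEquiv.smulLeft (Units.mk0 (-s⁻¹) (neg_ne_zero.mpr (inv_ne_zero hs.ne')))) η)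

theorem kernelS_apply (η : 𝓢(Sp N, ℝ)) (s : ℝ) (hs : 0 < s) (x y : Sp N) :
    kernelS η s hs x y = (s ^ N)⁻¹ * η (s⁻¹ • (x - y)) := by
  have : (-s⁻¹) • (y - x) = s⁻¹ • (x - y) := by rw [neg_smul, ← smul_neg, neg_sub]
  rw [← this]
  rfl

/-- The maximal function `M_η f(x) = sup_{s>0} |(f * η_s)(x)|`. -/
def maximalFn (η : 𝓢(Sp N, ℝ)) (f : Distr N) (x : Sp N) : ℝ≥0∞ :=
  ⨆ (s : ℝ) (hs : 0 < s), ENNReal.ofReal |f (kernelS η s hs x)|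

/-- The quasi-norm `‖f‖_{𝓗^q} = ‖M_η f‖_{L^q}`. -/
def hardyNorm (η : 𝓢(Sp N, ℝ)) (q : ℝ) (f : Distr N) : ℝ≥0∞ :=
  (∫⁻ x, maximalFn η f x ^ q) ^ (1 / q)

/-- `p ∈ L^1(0,T; 𝓗^q(ℝ^N))`, where the Hardy space is the set of tempered distributions `f`
with `M_η f ∈ L^q`. -/
structure MemL1Hardy (η : 𝓢(Sp N, ℝ)) (q T : ℝ) (p : ℝ → Distr N) : Prop where
  mem : ∀ᵐ t ∂(volume.restrict (Ioo 0 T)), hardyNorm η q (p t) < ⊤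
  meas : AEMeasurable (fun t => hardyNorm η q (p t)) (volume.restrict (Ioo 0 T))
  normL1 : ∫⁻ t in Ioo 0 T, hardyNorm η q (p t) < ⊤

/-! ### Weak solutions -/

/-- `∫ u(x,t) · φ(x) dx`. -/
def pair (u : ℝ → Sp N → Sp N) (φ : Sp N → Sp N) (t : ℝ) : ℝ :=
  ∫ x, inner ℝ (u t x) (φ x)

/-- `∫ u(x,t) ⊗ w(x,t) : ∇φ(x) dx`. -/
def tens (u w : ℝ → Sp N → Sp N) (φ : Sp N → Sp N) (t : ℝ) : ℝ :=
  ∫ x, ∑ i, ∑ j, u t x i * w t x j * pd i j φ x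

/-- `∫ |b(x,t)|² div φ(x) dx`. -/
def magn (b : ℝ → Sp N → Sp N) (φ : Sp N → Sp N) (t : ℝ) : ℝ :=
  ∫ x, ‖b t x‖ ^ 2 * divg φ x

/-- Weak solutions `(v,b,p)` of the MHD equations on `ℝ^N × (0,T)`. The fields
`int_vv, ..., int_magn` say that the quadratic integrals in the two identities exist; all the
other integrals exist by the first three fields. -/
structure IsWeakSolution (μ ν T : ℝ) (v b : ℝ → Sp N → Sp N) (p : ℝ → Distr N) : Prop where
  mem_v : MemL1L2σ T v
  mem_b : MemL1L2σ T b
  mem_p : MemL1Distr T p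
  int_vv : ∀ φ ξ, IsSpaceTest φ → IsTimeTest T ξ →
    IntegrableOn (fun t => tens v v φ t * ξ t) (Ioo 0 T)
  int_bb : ∀ φ ξ, IsSpaceTest φ → IsTimeTest T ξ →
    IntegrableOn (fun t => tens b b φ t * ξ t) (Ioo 0 T)
  int_vb : ∀ φ ξ, IsSpaceTest φ → IsTimeTest T ξ →
    IntegrableOn (fun t => tens v b φ t * ξ t) (Ioo 0 T)
  int_bv : ∀ φ ξ, IsSpaceTest φ → IsTimeTest T ξ →
    IntegrableOn (fun t => tens b v φ t * ξ t) (Ioo 0 T)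
  int_magn : ∀ φ ξ, IsSpaceTest φ → IsTimeTest T ξ →
    IntegrableOn (fun t => magn b φ t * ξ t) (Ioo 0 T)
  momentum : ∀ φ ξ, ∀ hφ : IsSpaceTest φ, IsTimeTest T ξ →
    -(∫ t in Ioo 0 T, pair v φ t * deriv ξ t) - (∫ t in Ioo 0 T, tens v v φ t * ξ t) =
      -(∫ t in Ioo 0 T, tens b b φ t * ξ t)
      + (∫ t in Ioo 0 T, p t (divS hφ) * ξ t)
      + 1 / 2 * (∫ t in Ioo 0 T, magn b φ t * ξ t)
      + ν * (∫ t in Ioo 0 T, pair v (Laplacian.laplacian φ) t * ξ t)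
  induction_eq : ∀ φ ξ, IsSpaceTest φ → IsTimeTest T ξ →
    -(∫ t in Ioo 0 T, pair b φ t * deriv ξ t) - (∫ t in Ioo 0 T, tens v b φ t * ξ t) =
      -(∫ t in Ioo 0 T, tens b v φ t * ξ t)
      + μ * (∫ t in Ioo 0 T, pair b (Laplacian.laplacian φ) t * ξ t)

/-- `b ∈ L^1(0,T; L^2_σ)` is a weak solution of the heat equation `∂_t b = μ Δ b` on
`ℝ^N × (0,T)`. -/
structure IsWeakHeatSolution (μ T : ℝ) (b : ℝ → Sp N → Sp N) : Prop where
  mem : MemL1L2σ T b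
  heat : ∀ φ ξ, IsSpaceTest φ → IsTimeTest T ξ →
    -(∫ t in Ioo 0 T, pair b φ t * deriv ξ t) =
      μ * (∫ t in Ioo 0 T, pair b (Laplacian.laplacian φ) t * ξ t)

end MHD

end

/-!
Testing the momentum equation with a gradient removes the time derivative and the viscous term, so
at almost every time `Δp = -∑ᵢⱼ ∂ᵢ∂ⱼ σᵢⱼ` with the integrable matrix
`σ = v ⊗ v - b ⊗ b + ½ |b|² I`. Under the rescaling `s^N f(s ·)`, `s → ∞`, the right-hand side tends
to `-∑ᵢⱼ (∫ σᵢⱼ) ∂ᵢ∂ⱼ δ₀`, while an integrable pressure tends to `(∫ p) δ₀`. Hence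
`(∫ p) Δδ₀ = -∑ᵢⱼ (∫ σᵢⱼ) ∂ᵢ∂ⱼ δ₀`, and the moments of order two give `∫ σₖₖ = -∫ p ≤ 0` for every
`k`. Rescaled pressures in `𝓗^q` tend to zero in `L^q` away from the origin once they are smeared;
their Laplacians being bounded, a sub-mean-value inequality makes them bounded and pointwise
convergent to zero, so that `∫ σₖₖ = 0`. In both cases
`∑ₖ ∫ σₖₖ = ∫ |v|² + (N/2 - 1) ∫ |b|² ≤ 0`.
-/

noncomputable section

open Filter Topology LineDeriv Laplacian

set_option maxSynthPendingDepth 3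

namespace MHD

/-! ### Schwartz functions and tempered distributions -/

section Schwartz

variable {E : Type*} [NormedAddCommGroup E] [NormedSpace ℝ E]

theorem lineDerivOp_comm (g : 𝓢(E, ℝ)) (a b : E) : ∂_{a} (∂_{b} g) = ∂_{b} (∂_{a} g) := by
  ext x
  have hs : IsSymmSndFDerivAt ℝ g x := (g.smooth 2).contDiffAt.isSymmSndFDerivAt (by simp)
  have hd : DifferentiableAt ℝ (fderiv ℝ g) x :=
    ((g.smooth 2).fderiv_right (m := 1) (by norm_num)).differentiable (by simp) x
  have snd (a b : E) : (∂_{a} (∂_{b} g) : 𝓢(E, ℝ)) x = fderiv ℝ (fderiv ℝ g) x a b := by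
    change fderiv ℝ (fun y => fderiv ℝ g y b) x a = _
    simp [fderiv_clm_apply hd (differentiableAt_const b)]
  rw [snd, snd, hs.eq]

theorem iteratedLineDerivOp_lineDerivOp_comm (g : 𝓢(E, ℝ)) {n : ℕ} (m : Fin n → E) (h : E) :
    ∂^{m} (∂_{h} g) = ∂_{h} (∂^{m} g) := by
  induction n with
  | zero => simp
  | succ n ih =>
    rw [iteratedLineDerivOp_succ_left, ih, iteratedLineDerivOp_succ_left, lineDerivOp_comm]

theorem differentiable_iteratedFDeriv_schwartz (g : 𝓢(E, ℝ)) (n : ℕ) :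
    Differentiable ℝ (iteratedFDeriv ℝ n g) :=
  (g.smooth ⊤).differentiable_iteratedFDeriv (mod_cast ENat.natCast_lt_top n)

theorem iteratedFDeriv_lineDerivOp (g : 𝓢(E, ℝ)) (n : ℕ) (h y : E) :
    iteratedFDeriv ℝ n (∂_{h} g : 𝓢(E, ℝ)) y = fderiv ℝ (iteratedFDeriv ℝ n g) y h := by
  ext m
  rw [← SchwartzMap.iteratedLineDerivOp_eq_iteratedFDeriv, iteratedLineDerivOp_lineDerivOp_comm,
    SchwartzMap.lineDerivOp_apply_eq_fderiv, ← fderiv_continuousMultilinear_apply_const_apply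
      (differentiable_iteratedFDeriv_schwartz g n y)]
  simp only [← SchwartzMap.iteratedLineDerivOp_eq_iteratedFDeriv]

theorem norm_iteratedFDeriv_add_sub_sub_fderiv_le (g : 𝓢(E, ℝ)) (n : ℕ) {x h : E} {B : ℝ}
    (hB : ∀ z ∈ Metric.closedBall x ‖h‖, ‖iteratedFDeriv ℝ (n + 2) g z‖ ≤ B) :
    ‖iteratedFDeriv ℝ n g (x + h) - iteratedFDeriv ℝ n g x
      - fderiv ℝ (iteratedFDeriv ℝ n g) x h‖ ≤ B * ‖h‖ ^ 2 := by
  have hx : x ∈ Metric.closedBall x ‖h‖ := Metric.mem_closedBall_self (norm_nonneg h)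
  have hB0 : 0 ≤ B := (norm_nonneg _).trans (hB x hx)
  have hderiv : ∀ z ∈ Metric.closedBall x ‖h‖,
      ‖fderiv ℝ (iteratedFDeriv ℝ n g) z - fderiv ℝ (iteratedFDeriv ℝ n g) x‖ ≤ B * ‖h‖ := by
    intro z hz
    calc _ = ‖iteratedFDeriv ℝ (n + 1) g z - iteratedFDeriv ℝ (n + 1) g x‖ := by
          rw [fderiv_iteratedFDeriv, Function.comp_apply, Function.comp_apply, ← map_sub,
            LinearIsometryEquiv.norm_map]
      _ ≤ B * ‖z - x‖ := (convex_closedBall x ‖h‖).norm_image_sub_le_of_norm_fderiv_le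
          (fun y _ => differentiable_iteratedFDeriv_schwartz g (n + 1) y)
          (fun y hy => norm_fderiv_iteratedFDeriv.trans_le (hB y hy)) hx hz
      _ ≤ B * ‖h‖ := by gcongr; exact mem_closedBall_iff_norm.1 hz
  have := (convex_closedBall x ‖h‖).norm_image_sub_le_of_norm_fderiv_le'
    (fun y _ => differentiable_iteratedFDeriv_schwartz g n y) hderiv hx (y := x + h) (by simp)
  rwa [add_sub_cancel_left, mul_assoc, ← sq] at this

theorem iteratedFDeriv_translate_sub_add_lineDerivOp (g : 𝓢(E, ℝ)) (n : ℕ) (h y : E) :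
    iteratedFDeriv ℝ n (SchwartzMap.compSubConstCLM ℝ h g - g + ∂_{h} g : 𝓢(E, ℝ)) y =
      iteratedFDeriv ℝ n g (y + -h) - iteratedFDeriv ℝ n g y
        - fderiv ℝ (iteratedFDeriv ℝ n g) y (-h) := by
  have hcd (f : 𝓢(E, ℝ)) : ContDiffAt ℝ n f y := (f.smooth n).contDiffAt
  have htrans : ContDiffAt ℝ n (fun z => g (z - h)) y := hcd (SchwartzMap.compSubConstCLM ℝ h g)
  have hcoe : ((SchwartzMap.compSubConstCLM ℝ h g - g + ∂_{h} g : 𝓢(E, ℝ)) : E → ℝ) =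
      ((fun z => g (z - h)) - ⇑g) + ⇑(∂_{h} g : 𝓢(E, ℝ)) := rfl
  rw [hcoe, iteratedFDeriv_add_apply (f := (fun z => g (z - h)) - ⇑g) (htrans.sub (hcd g)) (hcd _),
    iteratedFDeriv_sub_apply htrans (hcd g), iteratedFDeriv_comp_sub,
    iteratedFDeriv_lineDerivOp, map_neg, sub_neg_eq_add, ← sub_eq_add_neg]

theorem exists_seminorm_translate_sub_add_lineDerivOp_le (g : 𝓢(E, ℝ)) (k n : ℕ) :
    ∃ C, 0 ≤ C ∧ ∀ h : E, ‖h‖ ≤ 1 →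
      SchwartzMap.seminorm ℝ k n (SchwartzMap.compSubConstCLM ℝ h g - g + ∂_{h} g)
        ≤ C * ‖h‖ ^ 2 := by
  obtain ⟨C, hC0, hC⟩ : ∃ C, 0 ≤ C ∧ ∀ x, (1 + ‖x‖) ^ k * ‖iteratedFDeriv ℝ (n + 2) g x‖ ≤ C :=
    ⟨_, by positivity, fun x => SchwartzMap.one_add_le_sup_seminorm_apply (𝕜 := ℝ)
      (m := (k, n + 2)) le_rfl le_rfl g x⟩
  refine ⟨2 ^ k * C, by positivity, fun h hh =>
    SchwartzMap.seminorm_le_bound ℝ k n _ (by positivity) fun y => ?_⟩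
  have hball : ∀ z ∈ Metric.closedBall y ‖-h‖,
      ‖iteratedFDeriv ℝ (n + 2) g z‖ ≤ 2 ^ k * C / (1 + ‖y‖) ^ k := by
    intro z hz
    rw [le_div_iff₀ (by positivity)]
    have hyz : 1 + ‖y‖ ≤ 2 * (1 + ‖z‖) := by
      have := norm_sub_norm_le y z
      rw [mem_closedBall_iff_norm, norm_sub_rev, norm_neg] at hz
      linarith [norm_nonneg z]
    calc _ ≤ ‖iteratedFDeriv ℝ (n + 2) g z‖ * (2 * (1 + ‖z‖)) ^ k := by gcongr
      _ = 2 ^ k * ((1 + ‖z‖) ^ k * ‖iteratedFDeriv ℝ (n + 2) g z‖) := by rw [mul_pow]; ring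
      _ ≤ 2 ^ k * C := by gcongr; exact hC z
  have htaylor := norm_iteratedFDeriv_add_sub_sub_fderiv_le g n hball
  rw [iteratedFDeriv_translate_sub_add_lineDerivOp]
  calc _ ≤ (1 + ‖y‖) ^ k * (2 ^ k * C / (1 + ‖y‖) ^ k * ‖-h‖ ^ 2) := by
        gcongr
        linarith
    _ = _ := by rw [norm_neg]; field_simp

theorem exists_forall_abs_le_of_seminorm_le (f : 𝓢(E, ℝ) →L[ℝ] ℝ) {ι : Type*} {g : ι → 𝓢(E, ℝ)}
    {w : ι → ℝ} (hw : ∀ i, 0 ≤ w i)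
    (hg : ∀ k n, ∃ C, 0 ≤ C ∧ ∀ i, SchwartzMap.seminorm ℝ k n (g i) ≤ C * w i) :
    ∃ C, ∀ i, |f (g i)| ≤ C * w i := by
  obtain ⟨s, C, -, hf⟩ := Seminorm.bound_of_continuous (schwartz_withSeminorms ℝ E ℝ)
    ((normSeminorm ℝ ℝ).comp f.toLinearMap) (continuous_norm.comp f.continuous)
  choose c hc0 hc using hg
  refine ⟨C * ∑ a ∈ s, c a.1 a.2, fun i => ?_⟩
  have hsup : (s.sup (schwartzSeminormFamily ℝ E ℝ)) (g i) ≤ (∑ a ∈ s, c a.1 a.2) * w i := by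
    refine Seminorm.finset_sup_apply_le
      (mul_nonneg (Finset.sum_nonneg fun a _ => hc0 _ _) (hw i)) fun a ha => ?_
    exact (hc a.1 a.2 i).trans (mul_le_mul_of_nonneg_right
      (Finset.single_le_sum (f := fun a : ℕ × ℕ => c a.1 a.2) (fun a _ => hc0 _ _) ha) (hw i))
  calc |f (g i)| ≤ C * (s.sup (schwartzSeminormFamily ℝ E ℝ)) (g i) := hf _
    _ ≤ C * ((∑ a ∈ s, c a.1 a.2) * w i) := by gcongr
    _ = _ := by ring

/-- The function `x ↦ ⟨f, g(· - x)⟩`, i.e. the convolution of the tempered distribution `f` with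
the reflection of the Schwartz function `g`. -/
def smear (f : 𝓢(E, ℝ) →L[ℝ] ℝ) (g : 𝓢(E, ℝ)) (x : E) : ℝ :=
  f (SchwartzMap.compSubConstCLM ℝ x g)

theorem exists_abs_smear_add_sub_le (f : 𝓢(E, ℝ) →L[ℝ] ℝ) (g : 𝓢(E, ℝ)) (x : E) :
    ∃ C, ∀ h : E, ‖h‖ ≤ 1 →
      |smear f g (x + h) - smear f g x + smear f (∂_{h} g) x| ≤ C * ‖h‖ ^ 2 := by
  obtain ⟨C, hC⟩ := exists_forall_abs_le_of_seminorm_le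
    (f.comp (SchwartzMap.compSubConstCLM ℝ x)) (ι := {h : E // ‖h‖ ≤ 1})
    (g := fun h => SchwartzMap.compSubConstCLM ℝ h.1 g - g + ∂_{h.1} g)
    (w := fun h => ‖h.1‖ ^ 2) (fun h => by positivity) fun k n => by
      obtain ⟨C, hC0, hC⟩ := exists_seminorm_translate_sub_add_lineDerivOp_le g k n
      exact ⟨C, hC0, fun h => hC h.1 h.2⟩
  refine ⟨C, fun h hh => ?_⟩
  simpa [smear, SchwartzMap.compSubConstCLM_comp, add_comm h] using hC ⟨h, hh⟩

section FiniteDimensional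

variable [FiniteDimensional ℝ E] (f : 𝓢(E, ℝ) →L[ℝ] ℝ) (g : 𝓢(E, ℝ))

theorem exists_hasFDerivAt_smear (x : E) :
    ∃ L : E →L[ℝ] ℝ, (∀ h, L h = -smear f (∂_{h} g) x) ∧ HasFDerivAt (smear f g) L x := by
  let L : E →ₗ[ℝ] ℝ :=
    { toFun h := -smear f (∂_{h} g) x
      map_add' a b := by
        simp only [smear, lineDerivOp_left_add, map_add, neg_add_rev]
        ring
      map_smul' c a := by simp [smear, lineDerivOp_left_smul] }
  refine ⟨LinearMap.toContinuousLinearMap L, fun h => rfl, ?_⟩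
  obtain ⟨C, hC⟩ := exists_abs_smear_add_sub_le f g x
  rw [hasFDerivAt_iff_isLittleO_nhds_zero]
  have hO : (fun h : E => smear f g (x + h) - smear f g x - LinearMap.toContinuousLinearMap L h)
      =O[𝓝 0] fun h => ‖h‖ ^ 2 := by
    refine Asymptotics.IsBigO.of_bound C ?_
    filter_upwards [Metric.closedBall_mem_nhds (0 : E) one_pos] with h hh
    simpa [L, sub_neg_eq_add] using hC h (by simpa using hh)
  exact hO.trans_isLittleO (Asymptotics.isLittleO_norm_pow_id one_lt_two)

theorem differentiable_smear : Differentiable ℝ (smear f g) := fun x =>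
  let ⟨_, _, h⟩ := exists_hasFDerivAt_smear f g x
  h.differentiableAt

theorem fderiv_smear_apply (x h : E) : fderiv ℝ (smear f g) x h = -smear f (∂_{h} g) x := by
  obtain ⟨L, hL, hd⟩ := exists_hasFDerivAt_smear f g x
  rw [hd.fderiv, hL]

theorem contDiff_smear (n : ℕ) : ContDiff ℝ n (smear f g) := by
  induction n generalizing g with
  | zero => exact contDiff_zero.2 (differentiable_smear f g).continuous
  | succ n ih =>
    exact (contDiff_succ_iff_fderiv_apply (n := n)).2 ⟨differentiable_smear f g, by simp,
      fun h => by simpa only [fderiv_smear_apply] using (ih (∂_{h} g)).neg⟩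

end FiniteDimensional

theorem laplacian_smear {E : Type*} [NormedAddCommGroup E] [InnerProductSpace ℝ E]
    [FiniteDimensional ℝ E] (f : 𝓢(E, ℝ) →L[ℝ] ℝ) (g : 𝓢(E, ℝ)) :
    Δ (smear f g) = smear f (Δ g) := by
  have hcd : ContDiff ℝ 2 (smear f g) := contDiff_smear f g 2
  ext x
  have snd (a : E) : iteratedFDeriv ℝ 2 (smear f g) x ![a, a] = smear f (∂_{a} (∂_{a} g)) x := by
    have hd : DifferentiableAt ℝ (fderiv ℝ (smear f g)) x :=
      (hcd.fderiv_right (m := 1) (by norm_num)).differentiable one_ne_zero x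
    have happ : fderiv ℝ (fun y => fderiv ℝ (smear f g) y a) x a
        = fderiv ℝ (fderiv ℝ (smear f g)) x a a := by
      simp [fderiv_clm_apply hd (differentiableAt_const a)]
    simp only [iteratedFDeriv_two_apply, Matrix.cons_val_zero, Matrix.cons_val_one, ← happ,
      fderiv_smear_apply, fderiv_fun_neg, neg_apply, neg_neg]
  simp only [InnerProductSpace.laplacian_eq_iteratedFDeriv_stdOrthonormalBasis, snd, smear,
    SchwartzMap.laplacian_eq_sum (stdOrthonormalBasis ℝ E), map_sum]

end Schwartz

section CompactSupport

variable {E : Type*} [NormedAddCommGroup E] [NormedSpace ℝ E]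

/-- The product of a Schwartz function with the dilated cutoff `χ(c ·)`. -/
def cutoffMul {χ : E → ℝ} (hχ : HasCompactSupport χ) (hχ' : ContDiff ℝ ∞ χ) {c : ℝ} (hc : c ≠ 0)
    (g : 𝓢(E, ℝ)) : 𝓢(E, ℝ) :=
  HasCompactSupport.toSchwartzMap (f := fun x => χ (c • x) * g x) (hχ.comp_smul hc).mul_right
    ((hχ'.comp (contDiff_id.const_smul c)).mul (g.smooth ⊤))

theorem hasCompactSupport_cutoffMul {χ : E → ℝ} (hχ : HasCompactSupport χ) (hχ' : ContDiff ℝ ∞ χ)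
    {c : ℝ} (hc : c ≠ 0) (g : 𝓢(E, ℝ)) : HasCompactSupport (cutoffMul hχ hχ' hc g) :=
  (hχ.comp_smul hc).mul_right

theorem exists_seminorm_cutoffMul_le {χ : E → ℝ} (hχ : HasCompactSupport χ)
    (hχ' : ContDiff ℝ ∞ χ) (g : 𝓢(E, ℝ)) (k n : ℕ) :
    ∃ C, 0 ≤ C ∧ ∀ {c : ℝ} (hc : c ≠ 0), |c| ≤ 1 →
      SchwartzMap.seminorm ℝ k n (cutoffMul hχ hχ' hc g) ≤ C := by
  choose B hB0 hB using fun i : ℕ => show ∃ B, 0 ≤ B ∧ ∀ x, ‖iteratedFDeriv ℝ i χ x‖ ≤ B from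
    let ⟨B, hB0, hB⟩ := (hχ.toSchwartzMap hχ').decay 0 i
    ⟨B, hB0.le, fun x => by simpa using! hB x⟩
  refine ⟨∑ i ∈ Finset.range (n + 1), (n.choose i : ℝ) * B i * SchwartzMap.seminorm ℝ k (n - i) g,
    Finset.sum_nonneg fun i _ => mul_nonneg (mul_nonneg (by positivity) (hB0 i))
      (apply_nonneg _ _), fun {c} hc hc1 => SchwartzMap.seminorm_le_bound ℝ k n _
    (Finset.sum_nonneg fun i _ => mul_nonneg (mul_nonneg (by positivity) (hB0 i))
      (apply_nonneg _ _)) fun x => ?_⟩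
  have hχc (i : ℕ) : ‖iteratedFDeriv ℝ i (fun x => χ (c • x)) x‖ ≤ B i := by
    rw [iteratedFDeriv_comp_const_smul c (hχ'.of_le (by exact_mod_cast le_top)), norm_smul,
      norm_pow]
    exact (mul_le_of_le_one_left (norm_nonneg _) (pow_le_one₀ (norm_nonneg _) hc1)).trans
      (hB i _)
  calc _ ≤ ‖x‖ ^ k * ∑ i ∈ Finset.range (n + 1), (n.choose i : ℝ) *
        ‖iteratedFDeriv ℝ i (fun x => χ (c • x)) x‖ * ‖iteratedFDeriv ℝ (n - i) g x‖ := by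
        gcongr
        exact norm_iteratedFDeriv_mul_le (N := ∞) (hχ'.comp (contDiff_id.const_smul c))
          (g.smooth ⊤) x (mod_cast le_top)
    _ = ∑ i ∈ Finset.range (n + 1), (n.choose i : ℝ) *
        ‖iteratedFDeriv ℝ i (fun x => χ (c • x)) x‖ *
          (‖x‖ ^ k * ‖iteratedFDeriv ℝ (n - i) g x‖) := by
        rw [Finset.mul_sum]; exact Finset.sum_congr rfl fun i _ => by ring
    _ ≤ _ := by
        gcongr with i
        · exact mul_nonneg (by positivity) (hB0 i)
        · exact hχc i
        · exact SchwartzMap.le_seminorm ℝ k (n - i) g x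

theorem exists_seminorm_cutoffMul_sub_le {χ : E → ℝ} (hχ : HasCompactSupport χ)
    (hχ' : ContDiff ℝ ∞ χ) (hχ1 : ∀ x, ‖x‖ ≤ 1 → χ x = 1) (g : 𝓢(E, ℝ)) (k n : ℕ) :
    ∃ C, ∀ {c : ℝ} (hc : 0 < c), c ≤ 1 →
      SchwartzMap.seminorm ℝ k n (cutoffMul hχ hχ' hc.ne' g - g) ≤ C * c := by
  obtain ⟨C, hC0, hC⟩ := exists_seminorm_cutoffMul_le hχ hχ' g (k + 1) n
  refine ⟨C + SchwartzMap.seminorm ℝ (k + 1) n g, fun {c} hc hc1 => ?_⟩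
  set f := cutoffMul hχ hχ' hc.ne' g - g with hf
  have hfs : SchwartzMap.seminorm ℝ (k + 1) n f ≤ C + SchwartzMap.seminorm ℝ (k + 1) n g :=
    (map_sub_le_add _ _ _).trans
      (add_le_add (hC hc.ne' (by rwa [abs_of_pos hc])) le_rfl)
  refine SchwartzMap.seminorm_le_bound ℝ k n _ (by positivity) fun x => ?_
  rcases lt_or_ge (c * ‖x‖) 1 with hx | hx
  · have hf0 : (f : E → ℝ) =ᶠ[𝓝 x] 0 := by
      filter_upwards [(continuous_const.mul continuous_norm).continuousAt.eventually
        (gt_mem_nhds hx)] with z hz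
      have hχz : χ (c • z) = 1 := hχ1 _ (by rw [norm_smul, Real.norm_of_nonneg hc.le]; exact hz.le)
      simp [hf, cutoffMul, hχz]
    rw [(hf0.iteratedFDeriv ℝ n).eq_of_nhds]
    simp only [Pi.zero_def, iteratedFDeriv_fun_zero, Pi.zero_apply, norm_zero, mul_zero]
    positivity
  · calc ‖x‖ ^ k * ‖iteratedFDeriv ℝ n f x‖
        ≤ (c * ‖x‖) * (‖x‖ ^ k * ‖iteratedFDeriv ℝ n f x‖) :=
          le_mul_of_one_le_left (by positivity) hx
      _ = (‖x‖ ^ (k + 1) * ‖iteratedFDeriv ℝ n f x‖) * c := by ring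
      _ ≤ _ := by
          gcongr
          exact (SchwartzMap.le_seminorm ℝ (k + 1) n f x).trans hfs

theorem tendsto_cutoffMul {χ : E → ℝ} (hχ : HasCompactSupport χ) (hχ' : ContDiff ℝ ∞ χ)
    (hχ1 : ∀ x, ‖x‖ ≤ 1 → χ x = 1) (g : 𝓢(E, ℝ)) :
    Tendsto (fun n : ℕ => cutoffMul hχ hχ' (c := 1 / ((n : ℝ) + 1)) (by positivity) g) atTop
      (𝓝 g) := by
  rw [(schwartz_withSeminorms ℝ E ℝ).tendsto_nhds]
  rintro ⟨k, n⟩ ε hε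
  obtain ⟨C, hC⟩ := exists_seminorm_cutoffMul_sub_le hχ hχ' hχ1 g k n
  have hlim : Tendsto (fun n : ℕ => C * (1 / ((n : ℝ) + 1))) atTop (𝓝 0) := by
    simpa using tendsto_one_div_add_atTop_nhds_zero_nat.const_mul C
  filter_upwards [hlim.eventually (gt_mem_nhds hε)] with m hm
  exact (hC (by positivity) (div_le_one_of_le₀ (by simp) (by positivity))).trans_lt hm

/-- All the derivatives of a Schwartz function, with the topology of locally uniform convergence
of each of them. -/
def jet (g : 𝓢(E, ℝ)) (n : ℕ) : C(E, E [×n]→L[ℝ] ℝ) :=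
  ⟨iteratedFDeriv ℝ n g, (differentiable_iteratedFDeriv_schwartz g n).continuous⟩

theorem jet_injective : Function.Injective (jet (E := E)) := fun f g h => by
  ext x
  simpa [jet] using congrArg (fun J => J 0 x 0) h

variable [FiniteDimensional ℝ E]

theorem dense_hasCompactSupport : Dense {g : 𝓢(E, ℝ) | HasCompactSupport g} := fun g => by
  let χ : ContDiffBump (0 : E) := ⟨1, 2, one_pos, one_lt_two⟩
  exact mem_closure_of_tendsto (tendsto_cutoffMul χ.hasCompactSupport χ.contDiff
    (fun x hx => χ.one_of_mem_closedBall (by simpa using hx)) g)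
    (Eventually.of_forall fun n => hasCompactSupport_cutoffMul _ _ _ g)

theorem tendsto_of_tendsto_jet {ι : Type*} {l : Filter ι} {a : ι → 𝓢(E, ℝ)} {g : 𝓢(E, ℝ)} {R : ℝ}
    (ha : ∀ i, tsupport (a i) ⊆ Metric.closedBall 0 R) (hg : tsupport g ⊆ Metric.closedBall 0 R)
    (h : Tendsto (fun i => jet (a i)) l (𝓝 (jet g))) : Tendsto a l (𝓝 g) := by
  rw [(schwartz_withSeminorms ℝ E ℝ).tendsto_nhds]
  rintro ⟨k, n⟩ ε hε
  have hunif := Metric.tendstoUniformlyOn_iff.1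
    (ContinuousMap.tendsto_iff_forall_isCompact_tendstoUniformlyOn.1 (tendsto_pi_nhds.1 h n) _
      (isCompact_closedBall (0 : E) R)) (ε / (2 * (1 + |R|) ^ k)) (by positivity)
  filter_upwards [hunif] with i hi
  refine (SchwartzMap.seminorm_le_bound ℝ k n _ (M := ε / 2) (by positivity) fun x => ?_).trans_lt
    (half_lt_self hε)
  have hsub : iteratedFDeriv ℝ n (a i - g : 𝓢(E, ℝ)) x =
      iteratedFDeriv ℝ n (a i) x - iteratedFDeriv ℝ n g x :=
    iteratedFDeriv_sub_apply ((a i).smooth n).contDiffAt (g.smooth n).contDiffAt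
  rw [hsub]
  by_cases hx : x ∈ Metric.closedBall (0 : E) R
  · have hxR : ‖x‖ ≤ 1 + |R| := by linarith [mem_closedBall_zero_iff.1 hx, le_abs_self R]
    have hdist := (hi x hx).le
    rw [dist_comm, dist_eq_norm] at hdist
    calc _ ≤ (1 + |R|) ^ k * (ε / (2 * (1 + |R|) ^ k)) := by gcongr; exact hdist
      _ = ε / 2 := by field_simp
  · have hzero (f : 𝓢(E, ℝ)) (hf : tsupport f ⊆ Metric.closedBall 0 R) :
        iteratedFDeriv ℝ n f x = 0 :=
      image_eq_zero_of_notMem_tsupport fun h => hx (hf (tsupport_iteratedFDeriv_subset n h))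
    simp only [hzero _ (ha i), hzero _ hg, sub_zero, norm_zero, mul_zero]
    positivity

instance secondCountableTopology_continuousMultilinearMap (n : ℕ) :
    SecondCountableTopology (E [×n]→L[ℝ] ℝ) :=
  have : FiniteDimensional ℝ (E [×n]→L[ℝ] ℝ) := Module.Finite.of_injective
    (ContinuousMultilinearMap.toMultilinearMapLinear (R' := ℝ) :
      (E [×n]→L[ℝ] ℝ) →ₗ[ℝ] MultilinearMap ℝ (fun _ : Fin n => E) ℝ)
    ContinuousMultilinearMap.toMultilinearMap_injective
  have : ProperSpace (E [×n]→L[ℝ] ℝ) := FiniteDimensional.proper ℝ _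
  inferInstance

theorem exists_countable_subset_closure_tsupport_subset (R : ℝ) :
    ∃ A ⊆ {g : 𝓢(E, ℝ) | tsupport g ⊆ Metric.closedBall 0 R}, A.Countable ∧
      {g : 𝓢(E, ℝ) | tsupport g ⊆ Metric.closedBall 0 R} ⊆ closure A := by
  set D := {g : 𝓢(E, ℝ) | tsupport g ⊆ Metric.closedBall 0 R}
  have : ProperSpace E := FiniteDimensional.proper ℝ E
  obtain ⟨B, hBD, hBc, hDB⟩ :=
    (TopologicalSpace.IsSeparable.of_separableSpace (jet '' D)).exists_countable_dense_subset
  refine ⟨jet ⁻¹' B, fun g hg => ?_, hBc.preimage jet_injective, fun g hg => ?_⟩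
  · obtain ⟨g', hg', h⟩ := hBD hg
    rwa [← jet_injective h]
  · obtain ⟨b, hbB, hb⟩ := mem_closure_iff_seq_limit.1 (hDB (mem_image_of_mem jet hg))
    choose a haD ha using fun n => hBD (hbB n)
    refine mem_closure_of_tendsto (b := atTop) (tendsto_of_tendsto_jet haD hg ?_)
      (Eventually.of_forall fun n => ?_)
    · simpa only [ha] using hb
    · rw [mem_preimage, ha]
      exact hbB n

theorem exists_countable_dense_hasCompactSupport :
    ∃ A : Set 𝓢(E, ℝ), A.Countable ∧ (∀ g ∈ A, HasCompactSupport g) ∧ Dense A := by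
  have : ProperSpace E := FiniteDimensional.proper ℝ E
  choose A hAD hAc hA using exists_countable_subset_closure_tsupport_subset (E := E)
  refine ⟨⋃ n : ℕ, A n, countable_iUnion fun n => hAc n, fun g hg => ?_, ?_⟩
  · obtain ⟨n, hn⟩ := mem_iUnion.1 hg
    exact (isCompact_closedBall (0 : E) n).of_isClosed_subset (isClosed_tsupport g) (hAD n hn)
  · refine dense_hasCompactSupport.mono ?_ |>.of_closure
    intro g (hg : IsCompact (tsupport g))
    obtain ⟨r, hr⟩ := hg.isBounded.subset_closedBall 0
    obtain ⟨n, hn⟩ := exists_nat_ge r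
    exact closure_mono (subset_iUnion (fun n : ℕ => A n) n)
      (hA n (hr.trans (Metric.closedBall_subset_closedBall hn)))

end CompactSupport

/-! ### Functions with bounded Laplacian -/

section MeanValue

variable {E : Type*} [NormedAddCommGroup E]

/-- A smooth radial bump supported in the unit ball, the averaging profile whose Green identity
`MHD.integral_fderiv_mul_radialKernel` replaces integration over spheres. -/
def radialBump (y : E) : ℝ := Real.smoothTransition (1 - ‖y‖ ^ 2)

/-- The nonnegative radial function `k` with `∇Φ(y) = -k(y) y` for the bump `Φ = radialBump`. -/
def radialKernel (y : E) : ℝ := 2 * deriv Real.smoothTransition (1 - ‖y‖ ^ 2)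

theorem continuous_radialKernel : Continuous (radialKernel : E → ℝ) := by
  have : Continuous (deriv Real.smoothTransition) :=
    (Real.smoothTransition.contDiff (n := 1)).continuous_deriv le_rfl
  unfold radialKernel
  fun_prop

theorem radialKernel_nonneg (y : E) : 0 ≤ radialKernel y :=
  mul_nonneg zero_le_two Real.smoothTransition.monotone.deriv_nonneg

theorem radialBump_eq_zero {y : E} (hy : 1 < ‖y‖) : radialBump y = 0 :=
  Real.smoothTransition.zero_of_nonpos (by nlinarith)

theorem radialKernel_eq_zero {y : E} (hy : 1 < ‖y‖) : radialKernel y = 0 := by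
  have : Real.smoothTransition =ᶠ[𝓝 (1 - ‖y‖ ^ 2)] fun _ => 0 := by
    filter_upwards [gt_mem_nhds (show 1 - ‖y‖ ^ 2 < 0 by nlinarith)] with t ht
    exact Real.smoothTransition.zero_of_nonpos ht.le
  simp [radialKernel, this.deriv_eq]

variable [InnerProductSpace ℝ E]

theorem contDiff_radialBump : ContDiff ℝ ∞ (radialBump : E → ℝ) :=
  Real.smoothTransition.contDiff.comp (contDiff_const.sub (contDiff_norm_sq ℝ))

theorem fderiv_radialBump (y v : E) :
    fderiv ℝ radialBump y v = -(radialKernel y * inner ℝ y v) := by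
  have hT : HasDerivAt Real.smoothTransition _ (1 - ‖y‖ ^ 2) :=
    ((Real.smoothTransition.contDiff (n := 1)).differentiable (by simp) _).hasDerivAt
  have h := hT.comp_hasFDerivAt y ((hasStrictFDerivAt_norm_sq y).hasFDerivAt.const_sub 1)
  rw [show (radialBump : E → ℝ) = Real.smoothTransition ∘ fun y => 1 - ‖y‖ ^ 2 from rfl, h.fderiv]
  simp only [smul_neg, neg_apply, smul_apply, coe_innerSL_apply, nsmul_eq_mul, Nat.cast_ofNat,
    smul_eq_mul, radialKernel, neg_inj]
  ring

theorem fderiv_fderiv_comp_add_smul {u : E → ℝ} (hu : ContDiff ℝ 2 u) (x v : E) (r : ℝ) (y : E) :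
    fderiv ℝ (fun y => fderiv ℝ u (x + r • y) v) y v =
      r * fderiv ℝ (fderiv ℝ u) (x + r • y) v v := by
  have hline : HasFDerivAt (fun y : E => x + r • y) (r • ContinuousLinearMap.id ℝ E) y :=
    ((hasFDerivAt_id y).const_smul r).const_add x
  have hu' : Differentiable ℝ (fderiv ℝ u) :=
    (hu.fderiv_right (m := 1) (by norm_num)).differentiable (by simp)
  have h := ((hu' (x + r • y)).hasFDerivAt.comp y hline).clm_apply (hasFDerivAt_const v y)
  have := h.fderiv
  simp only [Function.comp_def] at this
  simp [this]

variable [FiniteDimensional ℝ E]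

theorem laplacian_eq_sum_fderiv_fderiv {ι : Type*} [Fintype ι] (e : OrthonormalBasis ι ℝ E)
    (u : E → ℝ) (x : E) : Δ u x = ∑ i, fderiv ℝ (fderiv ℝ u) x (e i) (e i) := by
  simp [InnerProductSpace.laplacian_eq_iteratedFDeriv_orthonormalBasis u e,
    iteratedFDeriv_two_apply]

theorem hasCompactSupport_radialBump : HasCompactSupport (radialBump : E → ℝ) :=
  .intro (isCompact_closedBall 0 1) fun _ hy => radialBump_eq_zero (by simpa using hy)

theorem hasCompactSupport_radialKernel : HasCompactSupport (radialKernel : E → ℝ) :=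
  .intro (isCompact_closedBall 0 1) fun _ hy => radialKernel_eq_zero (by simpa using hy)

variable [MeasurableSpace E] [BorelSpace E]

theorem integrable_radialBump : Integrable (radialBump : E → ℝ) :=
  contDiff_radialBump.continuous.integrable_of_hasCompactSupport hasCompactSupport_radialBump

theorem integrable_radialKernel : Integrable (radialKernel : E → ℝ) :=
  continuous_radialKernel.integrable_of_hasCompactSupport hasCompactSupport_radialKernel

theorem integral_radialKernel_pos [Nontrivial E] : 0 < ∫ y : E, radialKernel y := by
  obtain ⟨t, ht, hslope⟩ := exists_deriv_eq_slope Real.smoothTransition one_pos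
    Real.smoothTransition.continuous.continuousOn
    ((Real.smoothTransition.contDiff (n := 1)).differentiable (by simp)).differentiableOn
  obtain ⟨y, hy⟩ := exists_norm_eq E (Real.sqrt_nonneg (1 - t))
  refine continuous_radialKernel.integral_pos_of_hasCompactSupport_nonneg_nonzero
    hasCompactSupport_radialKernel radialKernel_nonneg (x := y) ?_
  rw [radialKernel, hy, Real.sq_sqrt (by linarith [ht.2]), sub_sub_cancel, hslope]
  simp

theorem integrable_comp_add_smul_mul_radialBump {w : E → ℝ} (hw : Continuous w) (x : E) (r : ℝ) :
    Integrable fun y => w (x + r • y) * radialBump y := by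
  have hΦ : Continuous (radialBump : E → ℝ) := contDiff_radialBump.continuous
  exact Continuous.integrable_of_hasCompactSupport (by fun_prop)
    hasCompactSupport_radialBump.mul_left

theorem integrable_comp_add_smul_mul_fderiv_radialBump {w : E → ℝ} (hw : Continuous w) (x : E)
    (r : ℝ) (v : E) : Integrable fun y => w (x + r • y) * fderiv ℝ radialBump y v := by
  have hΦ' : Continuous (fderiv ℝ (radialBump : E → ℝ)) :=
    contDiff_radialBump.continuous_fderiv (by simp)
  exact Continuous.integrable_of_hasCompactSupport (by fun_prop)
    (HasCompactSupport.mul_left (hasCompactSupport_radialBump.fderiv_apply ℝ v))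

theorem integral_fderiv_mul_fderiv_radialBump {u : E → ℝ} (hu : ContDiff ℝ 2 u) (x : E) (r : ℝ)
    (v : E) : ∫ y, fderiv ℝ u (x + r • y) v * fderiv ℝ radialBump y v =
      -(r * ∫ y, fderiv ℝ (fderiv ℝ u) (x + r • y) v v * radialBump y) := by
  have hu' : ContDiff ℝ 1 (fderiv ℝ u) := hu.fderiv_right (by norm_num)
  have hc : Continuous (fderiv ℝ u) := hu'.continuous
  have : Continuous (fderiv ℝ (fderiv ℝ u)) := hu'.continuous_fderiv (by simp)
  have : Differentiable ℝ (fderiv ℝ u) := hu'.differentiable (by simp)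
  have hint := integrable_comp_add_smul_mul_radialBump
    (show Continuous fun z => fderiv ℝ (fderiv ℝ u) z v v by fun_prop) x r
  rw [integral_mul_fderiv_eq_neg_fderiv_mul_of_integrable, ← integral_const_mul]
  · simp only [fderiv_fderiv_comp_add_smul hu, mul_assoc]
  · simpa only [fderiv_fderiv_comp_add_smul hu, mul_assoc] using hint.const_mul r
  · exact integrable_comp_add_smul_mul_fderiv_radialBump
      (show Continuous fun z => fderiv ℝ u z v by fun_prop) x r v
  · exact integrable_comp_add_smul_mul_radialBump
      (show Continuous fun z => fderiv ℝ u z v by fun_prop) x r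
  · exact fun y _ => by fun_prop
  · exact fun y _ => contDiff_radialBump.differentiable (by simp) y

/-- Green's identity for the pair `∇Φ = -k(y) y`, on the ball of radius `r` about `x`. -/
theorem integral_fderiv_mul_radialKernel {u : E → ℝ} (hu : ContDiff ℝ 2 u) (x : E) (r : ℝ) :
    ∫ y, fderiv ℝ u (x + r • y) y * radialKernel y = r * ∫ y, Δ u (x + r • y) * radialBump y := by
  set e := stdOrthonormalBasis ℝ E
  have hu' : ContDiff ℝ 1 (fderiv ℝ u) := hu.fderiv_right (by norm_num)
  have hc : Continuous (fderiv ℝ u) := hu'.continuous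
  have : Continuous (fderiv ℝ (fderiv ℝ u)) := hu'.continuous_fderiv (by simp)
  have hgrad (y : E) : fderiv ℝ u (x + r • y) y * radialKernel y =
      -∑ i, fderiv ℝ u (x + r • y) (e i) * fderiv ℝ radialBump y (e i) := by
    conv_lhs => rw [← e.sum_repr' y]
    rw [map_sum, Finset.sum_mul, ← Finset.sum_neg_distrib, e.sum_repr' y]
    refine Finset.sum_congr rfl fun i _ => ?_
    rw [fderiv_radialBump, map_smul, smul_eq_mul, real_inner_comm]
    ring
  simp_rw [hgrad, laplacian_eq_sum_fderiv_fderiv e, Finset.sum_mul]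
  rw [integral_neg, integral_finsetSum _ fun i _ => integrable_comp_add_smul_mul_fderiv_radialBump
      (show Continuous fun z => fderiv ℝ u z (e i) by fun_prop) x r (e i),
    integral_finsetSum _ fun i _ => integrable_comp_add_smul_mul_radialBump
      (show Continuous fun z => fderiv ℝ (fderiv ℝ u) z (e i) (e i) by fun_prop) x r,
    Finset.mul_sum, ← Finset.sum_neg_distrib]
  simp_rw [integral_fderiv_mul_fderiv_radialBump hu, neg_neg]

theorem hasDerivAt_integral_mul_radialKernel {u : E → ℝ} (hu : ContDiff ℝ 1 u) (x : E) (r : ℝ) :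
    HasDerivAt (fun r : ℝ => ∫ y, u (x + r • y) * radialKernel y)
      (∫ y, fderiv ℝ u (x + r • y) y * radialKernel y) r := by
  have : Continuous (fderiv ℝ u) := hu.continuous_fderiv (by simp)
  have huc : Continuous u := hu.continuous
  have hk : Continuous (radialKernel : E → ℝ) := continuous_radialKernel
  obtain ⟨C, hC⟩ : ∃ C, ∀ p ∈ Metric.closedBall r 1 ×ˢ Metric.closedBall (0 : E) 1,
      ‖fderiv ℝ u (x + p.1 • p.2) p.2‖ ≤ C :=
    ((isCompact_closedBall r 1).prod (isCompact_closedBall 0 1)).exists_bound_of_continuousOn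
      (by fun_prop)
  refine (hasDerivAt_integral_of_dominated_loc_of_deriv_le (s := Metric.closedBall r 1)
    (F := fun (r : ℝ) (y : E) => u (x + r • y) * radialKernel y)
    (F' := fun (r : ℝ) (y : E) => fderiv ℝ u (x + r • y) y * radialKernel y)
    (bound := fun y => C * radialKernel y) (Metric.closedBall_mem_nhds _ one_pos)
    (.of_forall fun r => Continuous.aestronglyMeasurable (by fun_prop)) ?_
    (Continuous.aestronglyMeasurable (by fun_prop)) (.of_forall fun y s hs => ?_)
    (integrable_radialKernel.const_mul C) (.of_forall fun y s _ => ?_)).2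
  · exact Continuous.integrable_of_hasCompactSupport (by fun_prop)
      hasCompactSupport_radialKernel.mul_left
  · rw [norm_mul, Real.norm_of_nonneg (radialKernel_nonneg y)]
    rcases le_or_gt ‖y‖ 1 with hy | hy
    · exact mul_le_mul_of_nonneg_right (hC (s, y) ⟨hs, by simpa using hy⟩) (radialKernel_nonneg y)
    · simp [radialKernel_eq_zero hy]
  · have hline : HasDerivAt (fun s : ℝ => x + s • y) y s := by
      simpa using ((hasDerivAt_id s).smul_const y).const_add x
    exact ((hu.differentiable (by simp) _).hasFDerivAt.comp_hasDerivAt s hline).mul_const _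

theorem integral_closedBall_eq_smul {F : Type*} [NormedAddCommGroup F] [NormedSpace ℝ F]
    (f : E → F) (x : E) {r : ℝ} (hr : 0 < r) :
    ∫ y in Metric.closedBall (0 : E) 1, f (x + r • y) =
      (r ^ Module.finrank ℝ E)⁻¹ • ∫ z in Metric.closedBall x r, f z := by
  have h := Measure.setIntegral_comp_smul_of_pos (volume : Measure E) (fun z => f (x + z))
    (Metric.closedBall 0 1) hr
  rw [smul_unitClosedBall_of_nonneg hr.le] at h
  rw [h, ← (measurePreserving_add_left volume x).setIntegral_image_emb
    (MeasurableEquiv.addLeft x).measurableEmbedding]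
  simp

theorem abs_integral_mul_radialKernel_sub_le {u : E → ℝ} (hu : ContDiff ℝ 2 u) {x : E} {R D : ℝ}
    (hR : 0 < R) (hD : ∀ z ∈ Metric.closedBall x R, |Δ u z| ≤ D) :
    |(∫ y, u (x + R • y) * radialKernel y) - u x * ∫ y : E, radialKernel y| ≤
      D * R ^ 2 * ∫ y : E, |radialBump y| := by
  have hderiv (r : ℝ) (hr : r ∈ Ico 0 R) :
      ‖∫ y, fderiv ℝ u (x + r • y) y * radialKernel y‖ ≤ R * (D * ∫ y : E, |radialBump y|) := by
    rw [integral_fderiv_mul_radialKernel hu, norm_mul, Real.norm_of_nonneg hr.1]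
    refine mul_le_mul hr.2.le ?_ (norm_nonneg _) hR.le
    rw [← integral_const_mul]
    refine norm_integral_le_of_norm_le (integrable_radialBump.abs.const_mul D)
      (.of_forall fun y => ?_)
    rw [norm_mul, Real.norm_eq_abs, Real.norm_eq_abs]
    rcases le_or_gt ‖y‖ 1 with hy | hy
    · refine mul_le_mul_of_nonneg_right (hD _ ?_) (abs_nonneg _)
      rw [mem_closedBall_iff_norm, add_sub_cancel_left, norm_smul, Real.norm_of_nonneg hr.1]
      nlinarith [norm_nonneg y, hr.1, hr.2]
    · simp [radialBump_eq_zero hy]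
  have := norm_image_sub_le_of_norm_deriv_le_segment'
    (fun r _ => (hasDerivAt_integral_mul_radialKernel (hu.of_le one_le_two) x r).hasDerivWithinAt)
    hderiv R ⟨hR.le, le_rfl⟩
  simp only [zero_smul, add_zero, integral_const_mul, Real.norm_eq_abs] at this
  exact this.trans_eq (by ring)

theorem exists_mean_value_bound (E : Type*) [NormedAddCommGroup E] [InnerProductSpace ℝ E]
    [FiniteDimensional ℝ E] [MeasurableSpace E] [BorelSpace E] [Nontrivial E] :
    ∃ C : ℝ, 0 < C ∧ ∀ (u : E → ℝ) (x : E) (R D : ℝ), ContDiff ℝ 2 u → 0 < R →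
      (∀ z ∈ Metric.closedBall x R, |Δ u z| ≤ D) →
      |u x| ≤ C * ((R ^ Module.finrank ℝ E)⁻¹ * ∫ z in Metric.closedBall x R, |u z|)
        + C * (D * R ^ 2) := by
  set I := ∫ y : E, radialKernel y
  have hI : 0 < I := integral_radialKernel_pos
  set J := ∫ y : E, |radialBump y|
  have hJ : 0 ≤ J := integral_nonneg fun _ => abs_nonneg _
  obtain ⟨K, hK⟩ := (continuous_radialKernel (E := E)).bounded_above_of_compact_support
    hasCompactSupport_radialKernel
  have hK0 : 0 ≤ K := (norm_nonneg _).trans (hK 0)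
  refine ⟨(K + J + 1) / I, by positivity, fun u x R D hu hR hD => ?_⟩
  have hD0 : 0 ≤ D := (abs_nonneg _).trans (hD x (Metric.mem_closedBall_self hR.le))
  have huc : Continuous u := hu.continuous
  rw [← smul_eq_mul (_⁻¹), ← integral_closedBall_eq_smul (fun z => |u z|) x hR]
  set S := ∫ y in Metric.closedBall (0 : E) 1, |u (x + R • y)|
  have hS : 0 ≤ S := integral_nonneg fun _ => abs_nonneg _
  have hmean : |∫ y, u (x + R • y) * radialKernel y| ≤ K * S := by
    rw [← setIntegral_eq_integral_of_forall_compl_eq_zero (s := Metric.closedBall (0 : E) 1)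
      fun y hy => by rw [radialKernel_eq_zero (by simpa using hy), mul_zero],
      ← Real.norm_eq_abs, ← integral_const_mul]
    refine norm_integral_le_of_norm_le (ContinuousOn.integrableOn_compact
      (isCompact_closedBall _ _) (by fun_prop)) (.of_forall fun y => ?_)
    rw [norm_mul, Real.norm_eq_abs, mul_comm]
    gcongr
    exact hK y
  have hle : |u x| * I ≤ K * S + D * R ^ 2 * J := by
    have h := (abs_sub_abs_le_abs_sub (u x * I) _).trans_eq (abs_sub_comm _ _)
      |>.trans (abs_integral_mul_radialKernel_sub_le hu hR hD)
    rw [abs_mul, abs_of_pos hI] at h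
    linarith
  rw [← mul_add, div_mul_eq_mul_div, le_div_iff₀ hI]
  refine hle.trans ?_
  have : 0 ≤ D * R ^ 2 := by positivity
  nlinarith [mul_nonneg hJ hS, mul_nonneg hK0 this]

end MeanValue

section LocalBound

theorem setIntegral_abs_le_rpow_mul {α : Type*} [MeasurableSpace α] {μ : Measure α} {S : Set α}
    (hS : MeasurableSet S) {w : α → ℝ} {K q : ℝ} (hq : 0 ≤ q) (hq1 : q ≤ 1)
    (hw : IntegrableOn w S μ)
    (hwq : IntegrableOn (fun z => |w z| ^ q) S μ) (hK : ∀ z ∈ S, |w z| ≤ K) :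
    ∫ z in S, |w z| ∂μ ≤ K ^ (1 - q) * ∫ z in S, |w z| ^ q ∂μ := by
  rw [← integral_const_mul]
  refine setIntegral_mono_on hw.abs (hwq.const_mul _) hS fun z hz => ?_
  have hq1' : 0 ≤ 1 - q := by linarith
  calc |w z| = |w z| ^ ((1 - q) + q) := by simp
    _ = |w z| ^ (1 - q) * |w z| ^ q := Real.rpow_add_of_nonneg (abs_nonneg _) hq1' hq
    _ ≤ K ^ (1 - q) * |w z| ^ q := by
      gcongr
      exact hK z hz

variable {E : Type*} [NormedAddCommGroup E]

/-- Maximizing `(ρ - ‖z - x‖) ^ n |u z| ^ q` over the ball produces a smaller ball, about a point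
where `|u|` is not smaller, on which `|u|` is comparable to its value at the center. -/
theorem exists_closedBall_forall_abs_le [ProperSpace E] {u : E → ℝ} (hu : Continuous u) {x : E}
    {ρ q : ℝ} (hρ : 0 < ρ) (hq : 0 < q) {n : ℕ} (hn : n ≠ 0) (hx : u x ≠ 0) :
    ∃ (z₀ : E) (d : ℝ), 0 < d ∧ d ≤ ρ ∧
      Metric.closedBall z₀ (d / 2) ⊆ Metric.closedBall x ρ ∧
      ρ ^ n * |u x| ^ q ≤ d ^ n * |u z₀| ^ q ∧
      ∀ z ∈ Metric.closedBall z₀ (d / 2), |u z| ≤ 2 ^ (n / q) * |u z₀| := by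
  have hcont : Continuous fun z => (ρ - ‖z - x‖) ^ n * |u z| ^ q := by
    fun_prop (disch := exact hq.le)
  obtain ⟨z₀, hz₀, hmax⟩ := (isCompact_closedBall x ρ).exists_isMaxOn
    ⟨x, Metric.mem_closedBall_self hρ.le⟩ hcont.continuousOn
  set d := ρ - ‖z₀ - x‖ with hd
  have hx₀ : ρ ^ n * |u x| ^ q ≤ d ^ n * |u z₀| ^ q := by
    simpa using hmax (Metric.mem_closedBall_self hρ.le)
  have hd0 : 0 < d := by
    refine (sub_nonneg.2 (mem_closedBall_iff_norm.1 hz₀)).lt_of_ne' fun h => ?_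
    rw [← hd] at h
    rw [h, zero_pow hn, zero_mul] at hx₀
    exact hx₀.not_gt (by positivity)
  have hdist {z : E} (hz : z ∈ Metric.closedBall z₀ (d / 2)) : ‖z - x‖ ≤ ρ - d / 2 := by
    have := norm_sub_le_norm_sub_add_norm_sub z z₀ x
    rw [mem_closedBall_iff_norm] at hz
    linarith
  refine ⟨z₀, d, hd0, by simp [hd], fun z hz => ?_, hx₀, fun z hz => ?_⟩
  · rw [mem_closedBall_iff_norm]
    linarith [hdist hz]
  · have hle : (d / 2) ^ n * |u z| ^ q ≤ d ^ n * |u z₀| ^ q := by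
      refine le_trans (mul_le_mul_of_nonneg_right (pow_le_pow_left₀ (by positivity) ?_ n)
        (by positivity)) (hmax (mem_closedBall_iff_norm.2 ((hdist hz).trans (by linarith))))
      linarith [hdist hz]
    rw [div_pow, div_mul_eq_mul_div, div_le_iff₀ (by positivity), mul_assoc,
      mul_le_mul_iff_right₀ (by positivity)] at hle
    rw [← Real.rpow_le_rpow_iff (abs_nonneg _) (by positivity) hq,
      Real.mul_rpow (by positivity) (abs_nonneg _), ← Real.rpow_mul zero_le_two,
      div_mul_cancel₀ _ hq.ne', Real.rpow_natCast, mul_comm]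
    exact hle

theorem exists_rpow_mul_le_or_abs_le_of_forall_abs_le (E : Type*) [NormedAddCommGroup E]
    [InnerProductSpace ℝ E] [FiniteDimensional ℝ E] [MeasurableSpace E] [BorelSpace E]
    [Nontrivial E] {q : ℝ} (hq : 0 < q) (hq1 : q ≤ 1) :
    ∃ C : ℝ, 0 < C ∧ ∀ (u : E → ℝ) (z₀ : E) (r κ D : ℝ), ContDiff ℝ 2 u → 0 < r → 0 ≤ κ →
      (∀ z ∈ Metric.closedBall z₀ r, |Δ u z| ≤ D) →
      (∀ z ∈ Metric.closedBall z₀ r, |u z| ≤ κ * |u z₀|) →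
      r ^ Module.finrank ℝ E * |u z₀| ^ q ≤
        C * (κ ^ (1 - q) * ∫ z in Metric.closedBall z₀ r, |u z| ^ q) ∨
      |u z₀| ≤ C * (D * r ^ 2) := by
  obtain ⟨C, hC, hmean⟩ := exists_mean_value_bound E
  refine ⟨2 * C, by positivity, fun u z₀ r κ D hu hr hκ hD hball => ?_⟩
  set n := Module.finrank ℝ E
  set m := |u z₀|
  rcases le_or_gt m (2 * C * (D * r ^ 2)) with hcase | hcase
  · exact .inr hcase
  left
  have huc : Continuous u := hu.continuous
  have huq : Continuous fun z => |u z| ^ q := by fun_prop (disch := exact hq.le)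
  have hD0 : 0 ≤ D := (abs_nonneg _).trans (hD z₀ (Metric.mem_closedBall_self hr.le))
  have hm : 0 < m := lt_of_le_of_lt (by positivity) hcase
  set I := ∫ z in Metric.closedBall z₀ r, |u z| ^ q
  have hL1 : ∫ z in Metric.closedBall z₀ r, |u z| ≤ (κ * m) ^ (1 - q) * I :=
    setIntegral_abs_le_rpow_mul measurableSet_closedBall hq.le hq1
      (huc.continuousOn.integrableOn_compact (isCompact_closedBall _ _))
      (huq.continuousOn.integrableOn_compact (isCompact_closedBall _ _)) hball
  have hsplit : m = m ^ q * m ^ (1 - q) := by rw [← Real.rpow_add hm]; simp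
  have hmI : r ^ n * m ≤ 2 * C * (κ ^ (1 - q) * I) * m ^ (1 - q) := by
    calc r ^ n * m ≤ r ^ n * (2 * (C * ((r ^ n)⁻¹ * ((κ * m) ^ (1 - q) * I)))) := by
          gcongr
          have : C * ((r ^ n)⁻¹ * ∫ z in Metric.closedBall z₀ r, |u z|) ≤
            C * ((r ^ n)⁻¹ * ((κ * m) ^ (1 - q) * I)) := by gcongr
          linarith [hmean u z₀ r D hu hr hD]
      _ = 2 * C * (κ ^ (1 - q) * I) * m ^ (1 - q) * (r ^ n * (r ^ n)⁻¹) := by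
          rw [Real.mul_rpow hκ hm.le]
          ring
      _ = _ := by rw [mul_inv_cancel₀ (by positivity), mul_one]
  refine le_of_mul_le_mul_right ?_ (show 0 < m ^ (1 - q) by positivity)
  rwa [mul_assoc, ← hsplit]

theorem exists_rpow_mul_le_integral_or_abs_le (E : Type*) [NormedAddCommGroup E]
    [InnerProductSpace ℝ E] [FiniteDimensional ℝ E] [MeasurableSpace E] [BorelSpace E]
    [Nontrivial E] {q : ℝ} (hq : 0 < q) (hq1 : q ≤ 1) :
    ∃ C : ℝ, 0 < C ∧ ∀ (u : E → ℝ) (x : E) (ρ D : ℝ), ContDiff ℝ 2 u → 0 < ρ →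
      (∀ z ∈ Metric.closedBall x ρ, |Δ u z| ≤ D) →
      ρ ^ Module.finrank ℝ E * |u x| ^ q ≤ C * (∫ z in Metric.closedBall x ρ, |u z| ^ q) ∨
      |u x| ≤ C * (D * ρ ^ 2) := by
  obtain ⟨C, hC, hcenter⟩ := exists_rpow_mul_le_or_abs_le_of_forall_abs_le E hq hq1
  set n := Module.finrank ℝ E
  set A : ℝ := 2 ^ n * ((2 : ℝ) ^ (n / q)) ^ (1 - q)
  refine ⟨C * A + C, by positivity, fun u x ρ D hu hρ hD => ?_⟩
  have hD0 : 0 ≤ D := (abs_nonneg _).trans (hD x (Metric.mem_closedBall_self hρ.le))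
  rcases eq_or_ne (u x) 0 with hx | hx
  · right
    rw [hx, abs_zero]
    positivity
  have huq : Continuous fun z => |u z| ^ q := by
    have := hu.continuous
    fun_prop (disch := exact hq.le)
  have hn : n ≠ 0 := (Module.finrank_pos (R := ℝ) (M := E)).ne'
  obtain ⟨z₀, d, hd, hdρ, hsub, hx₀, hball⟩ :=
    exists_closedBall_forall_abs_le hu.continuous hρ hq hn hx
  rcases hcenter u z₀ (d / 2) _ D hu (by positivity) (by positivity)
    (fun z hz => hD z (hsub hz)) hball with hlarge | hsmall
  · left
    calc ρ ^ n * |u x| ^ q ≤ 2 ^ n * ((d / 2) ^ n * |u z₀| ^ q) := by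
          rwa [div_pow, div_mul_eq_mul_div, mul_div_cancel₀ _ (by positivity)]
      _ ≤ 2 ^ n * (C * (((2 : ℝ) ^ (n / q)) ^ (1 - q) *
            ∫ z in Metric.closedBall z₀ (d / 2), |u z| ^ q)) := by gcongr
      _ = C * A * ∫ z in Metric.closedBall z₀ (d / 2), |u z| ^ q := by simp only [A]; ring
      _ ≤ (C * A + C) * ∫ z in Metric.closedBall x ρ, |u z| ^ q := by
          refine mul_le_mul (by linarith) ?_ (by positivity) (by positivity)
          exact setIntegral_mono_set (huq.continuousOn.integrableOn_compact
            (isCompact_closedBall _ _)) (.of_forall fun z => by positivity) hsub.eventuallyLE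
  · right
    calc |u x| ≤ |u z₀| := by
          rw [← Real.rpow_le_rpow_iff (abs_nonneg _) (abs_nonneg _) hq]
          refine le_of_mul_le_mul_left (hx₀.trans ?_) (pow_pos hρ n)
          gcongr
      _ ≤ C * (D * (d / 2) ^ 2) := hsmall
      _ ≤ (C * A + C) * (D * ρ ^ 2) := by
          gcongr
          · linarith [show 0 ≤ C * A by positivity]
          · linarith

end LocalBound

/-! ### Rescaled tempered distributions -/

section Rescale

variable {E : Type*} [NormedAddCommGroup E] [InnerProductSpace ℝ E]

/-- The dilation `x ↦ ψ (c x)` of a Schwartz function. -/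
def dilate (c : ℝˣ) : 𝓢(E, ℝ) →L[ℝ] 𝓢(E, ℝ) :=
  SchwartzMap.compCLMOfContinuousLinearEquiv ℝ (ContinuousLinearEquiv.smulLeft c)

theorem dilate_apply (c : ℝˣ) (ψ : 𝓢(E, ℝ)) (x : E) : dilate c ψ x = ψ ((c : ℝ) • x) := rfl

theorem lineDerivOp_dilate (c : ℝˣ) (v : E) (ψ : 𝓢(E, ℝ)) :
    ∂_{v} (dilate c ψ) = (c : ℝ) • dilate c (∂_{v} ψ) := by
  have hv : (ContinuousLinearEquiv.smulLeft c : E ≃L[ℝ] E) v = (c : ℝ) • v := rfl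
  rw [dilate, SchwartzMap.lineDerivOp_compCLMOfContinuousLinearEquiv, hv, lineDerivOp_left_smul,
    map_smul]

theorem lineDerivOp_compSubConstCLM (a v : E) (ψ : 𝓢(E, ℝ)) :
    ∂_{v} (SchwartzMap.compSubConstCLM ℝ a ψ) = SchwartzMap.compSubConstCLM ℝ a (∂_{v} ψ) := by
  ext x
  simp only [SchwartzMap.lineDerivOp_apply_eq_fderiv, SchwartzMap.compSubConstCLM_apply,
    ← fderiv_comp_sub]
  rfl

theorem lineDerivOp_lineDerivOp_dilate_compSubConstCLM (c : ℝˣ) (a v w : E) (ψ : 𝓢(E, ℝ)) :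
    ∂_{v} (∂_{w} (dilate c (SchwartzMap.compSubConstCLM ℝ a ψ))) =
      (c : ℝ) ^ 2 • dilate c (SchwartzMap.compSubConstCLM ℝ a (∂_{v} (∂_{w} ψ))) := by
  simp only [lineDerivOp_dilate, lineDerivOp_compSubConstCLM, lineDerivOp_smul, smul_smul, sq]

theorem laplacian_dilate_compSubConstCLM [FiniteDimensional ℝ E] (c : ℝˣ) (a : E) (ψ : 𝓢(E, ℝ)) :
    Δ (dilate c (SchwartzMap.compSubConstCLM ℝ a ψ)) =
      (c : ℝ) ^ 2 • dilate c (SchwartzMap.compSubConstCLM ℝ a (Δ ψ)) := by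
  simp only [SchwartzMap.laplacian_eq_sum (stdOrthonormalBasis ℝ E), map_sum, Finset.smul_sum,
    lineDerivOp_lineDerivOp_dilate_compSubConstCLM]

/-- The tempered distribution `ψ ↦ ⟨f, ψ(·/s)⟩`; for a function `f` it is `s^d f(s ·)`, which for
large `s` concentrates at the origin with the mass of `f`. -/
def rescale (s : ℝˣ) (f : 𝓢(E, ℝ) →L[ℝ] ℝ) : 𝓢(E, ℝ) →L[ℝ] ℝ := f.comp (dilate s⁻¹)

theorem smear_rescale_apply (s : ℝˣ) (f : 𝓢(E, ℝ) →L[ℝ] ℝ) (ψ : 𝓢(E, ℝ)) (x : E) :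
    smear (rescale s f) ψ x = f (dilate s⁻¹ (SchwartzMap.compSubConstCLM ℝ x ψ)) := rfl

variable [MeasurableSpace E] [BorelSpace E] [FiniteDimensional ℝ E]
  {ι : Type*} [Fintype ι] (e : OrthonormalBasis ι ℝ E)

theorem norm_integral_mul_le {α : Type*} [MeasurableSpace α] {μ : Measure α} {F g : α → ℝ}
    (hF : Integrable F μ) {B : ℝ} (hg : ∀ x, ‖g x‖ ≤ B) :
    ‖∫ x, F x * g x ∂μ‖ ≤ (∫ x, ‖F x‖ ∂μ) * B := by
  rw [← integral_mul_const]
  refine norm_integral_le_of_norm_le (hF.norm.mul_const B) (.of_forall fun x => ?_)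
  rw [norm_mul]
  exact mul_le_mul_of_nonneg_left (hg x) (norm_nonneg _)

theorem integrable_mul_schwartz {F : E → ℝ} (hF : Integrable F) (ψ : 𝓢(E, ℝ)) :
    Integrable fun x => F x * ψ x :=
  hF.mul_bdd ψ.continuous.aestronglyMeasurable
    (.of_forall fun x => SchwartzMap.norm_le_seminorm ℝ ψ x)

/-- The tempered distribution `ψ ↦ ∫ F ψ` of an integrable function `F`. -/
def ofIntegrable {F : E → ℝ} (hF : Integrable F) : 𝓢(E, ℝ) →L[ℝ] ℝ :=
  SchwartzMap.mkCLMtoNormedSpace (𝕜 := ℝ) (𝕜' := ℝ) (σ := RingHom.id ℝ)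
    (fun ψ => ∫ x, F x * ψ x)
    (fun ψ φ => by
      simp only [add_apply, mul_add]
      exact integral_add (integrable_mul_schwartz hF ψ) (integrable_mul_schwartz hF φ))
    (fun c ψ => by
      simp only [smul_apply, smul_eq_mul, mul_left_comm _ c, integral_const_mul, RingHom.id_apply])
    ⟨{(0, 0)}, ∫ x, ‖F x‖, integral_nonneg fun _ => norm_nonneg _, fun ψ => by
      simpa using norm_integral_mul_le hF (SchwartzMap.norm_le_seminorm ℝ ψ)⟩

theorem tendsto_integral_mul_comp_smul_sub {F : E → ℝ} (hF : Integrable F) (g : 𝓢(E, ℝ))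
    {c : ℕ → ℝ} (hc : Tendsto c atTop (𝓝 0)) (x : E) :
    Tendsto (fun n => ∫ y, F y * g (c n • y - x)) atTop (𝓝 ((∫ y, F y) * g (-x))) := by
  rw [← integral_mul_const]
  refine tendsto_integral_of_dominated_convergence
    (fun y => ‖F y‖ * SchwartzMap.seminorm ℝ 0 0 g) (fun n => ?_) (hF.norm.mul_const _)
    (fun n => .of_forall fun y => ?_) (.of_forall fun y => ?_)
  · have : Continuous fun y => g (c n • y - x) := g.continuous.comp (by fun_prop)
    exact hF.aestronglyMeasurable.mul this.aestronglyMeasurable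
  · rw [norm_mul]
    gcongr
    exact SchwartzMap.norm_le_seminorm ℝ g _
  · refine ((g.continuous.tendsto _).comp ?_).const_mul _
    simpa using (hc.smul_const y).sub_const x

/-- The pairing `∑ᵢⱼ ∫ Fᵢⱼ ∂ᵢ ∂ⱼ ψ` of the matrix field `F` with the Hessian of `ψ`, both written in
the basis `e`. -/
def hessianPairing (F : ι → ι → E → ℝ) (ψ : 𝓢(E, ℝ)) : ℝ :=
  ∑ i, ∑ j, ∫ x, F i j x * ∂_{e i} (∂_{e j} ψ) x

theorem continuous_hessianPairing {F : ι → ι → E → ℝ} (hF : ∀ i j, Integrable (F i j)) :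
    Continuous (hessianPairing e F) := by
  refine continuous_finsetSum _ fun i _ => continuous_finsetSum _ fun j _ => ?_
  exact (ofIntegrable (hF i j)).continuous.comp <|
    (lineDerivOpCLM ℝ 𝓢(E, ℝ) (e i)).continuous.comp (lineDerivOpCLM ℝ 𝓢(E, ℝ) (e j)).continuous

theorem hessianPairing_dilate_compSubConstCLM (F : ι → ι → E → ℝ) (c : ℝˣ) (a : E)
    (ψ : 𝓢(E, ℝ)) :
    hessianPairing e F (dilate c (SchwartzMap.compSubConstCLM ℝ a ψ)) =
      (c : ℝ) ^ 2 * ∑ i, ∑ j, ∫ x, F i j x * ∂_{e i} (∂_{e j} ψ) ((c : ℝ) • x - a) := by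
  simp only [hessianPairing, lineDerivOp_lineDerivOp_dilate_compSubConstCLM, smul_apply,
    smul_eq_mul, mul_left_comm (F _ _ _), integral_const_mul, ← Finset.mul_sum, dilate_apply,
    SchwartzMap.compSubConstCLM_apply]

section Laplacian

variable {e} {f : 𝓢(E, ℝ) →L[ℝ] ℝ} {F : ι → ι → E → ℝ}

theorem laplacian_smear_rescale (hf : ∀ φ, f (Δ φ) = -hessianPairing e F φ) (s : ℝˣ)
    (ψ : 𝓢(E, ℝ)) (x : E) :
    Δ (smear (rescale s f) ψ) x =
      -∑ i, ∑ j, ∫ y, F i j y * ∂_{e i} (∂_{e j} ψ) ((s : ℝ)⁻¹ • y - x) := by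
  have hs : (s : ℝ) ^ 2 * (s : ℝ)⁻¹ ^ 2 = 1 := by simp
  have hΔ : dilate s⁻¹ (SchwartzMap.compSubConstCLM ℝ x (Δ ψ)) =
      (s : ℝ) ^ 2 • Δ (dilate s⁻¹ (SchwartzMap.compSubConstCLM ℝ x ψ)) := by
    rw [laplacian_dilate_compSubConstCLM, smul_smul, Units.val_inv_eq_inv_val, hs, one_smul]
  calc Δ (smear (rescale s f) ψ) x
      = (s : ℝ) ^ 2 * -hessianPairing e F (dilate s⁻¹ (SchwartzMap.compSubConstCLM ℝ x ψ)) := by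
        rw [laplacian_smear, ← hf, ← smul_eq_mul, ← map_smul, ← hΔ, smear_rescale_apply]
    _ = _ := by
        rw [hessianPairing_dilate_compSubConstCLM, Units.val_inv_eq_inv_val, mul_neg, ← mul_assoc,
          hs, one_mul]

theorem exists_abs_laplacian_smear_rescale_le (hF : ∀ i j, Integrable (F i j))
    (hf : ∀ φ, f (Δ φ) = -hessianPairing e F φ) (ψ : 𝓢(E, ℝ)) :
    ∃ D, ∀ s x, |Δ (smear (rescale s f) ψ) x| ≤ D := by
  refine ⟨∑ i, ∑ j, (∫ y, ‖F i j y‖) * SchwartzMap.seminorm ℝ 0 0 (∂_{e i} (∂_{e j} ψ)),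
    fun s x => ?_⟩
  rw [laplacian_smear_rescale hf, abs_neg]
  refine (Finset.abs_sum_le_sum_abs _ _).trans (Finset.sum_le_sum fun i _ => ?_)
  refine (Finset.abs_sum_le_sum_abs _ _).trans (Finset.sum_le_sum fun j _ => ?_)
  exact norm_integral_mul_le (hF i j) fun y => SchwartzMap.norm_le_seminorm ℝ _ _

theorem tendsto_laplacian_smear_rescale (hF : ∀ i j, Integrable (F i j))
    (hf : ∀ φ, f (Δ φ) = -hessianPairing e F φ) (ψ : 𝓢(E, ℝ)) {s : ℕ → ℝˣ}
    (hs : Tendsto (fun n => (s n : ℝ)) atTop atTop) (x : E) :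
    Tendsto (fun n => Δ (smear (rescale (s n) f) ψ) x) atTop
      (𝓝 (-∑ i, ∑ j, (∫ y, F i j y) * ∂_{e i} (∂_{e j} ψ) (-x))) := by
  simp only [laplacian_smear_rescale hf]
  exact (tendsto_finsetSum _ fun i _ => tendsto_finsetSum _ fun j _ =>
    tendsto_integral_mul_comp_smul_sub (hF i j) _ (tendsto_inv_atTop_zero.comp hs) x).neg

end Laplacian

end Rescale

/-! ### The mass of the stress matrix -/

section Mass

variable {E : Type*} [NormedAddCommGroup E] [InnerProductSpace ℝ E]

theorem hasCompactSupport_fderiv_fderiv_apply {g : E → ℝ} (hg : HasCompactSupport g) (v : E) :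
    HasCompactSupport fun x => fderiv ℝ (fderiv ℝ g) x v v :=
  ((hg.fderiv ℝ).fderiv ℝ).mono fun x hx h => hx (by simp [h])

theorem continuous_fderiv_fderiv_apply {u : E → ℝ} (hu : ContDiff ℝ 2 u) (v : E) :
    Continuous fun x => fderiv ℝ (fderiv ℝ u) x v v :=
  (((hu.fderiv_right (m := 1) (by norm_num)).continuous_fderiv one_ne_zero).clm_apply
    continuous_const).clm_apply continuous_const

variable [FiniteDimensional ℝ E]

theorem hasCompactSupport_laplacian {F : Type*} [NormedAddCommGroup F] [NormedSpace ℝ F] {g : E → F}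
    (hg : HasCompactSupport g) : HasCompactSupport (Δ g) :=
  (hg.iteratedFDeriv (𝕜 := ℝ) 2).mono fun x hx h => hx (by
    simp [InnerProductSpace.laplacian_eq_iteratedFDeriv_stdOrthonormalBasis, h])

theorem continuous_laplacian {u : E → ℝ} (hu : ContDiff ℝ 2 u) : Continuous (Δ u) := by
  rw [funext (laplacian_eq_sum_fderiv_fderiv (stdOrthonormalBasis ℝ E) u)]
  exact continuous_finsetSum _ fun i _ => continuous_fderiv_fderiv_apply hu _

variable [MeasurableSpace E] [BorelSpace E]

theorem integral_mul_fderiv_fderiv_eq {u g : E → ℝ} (hu : ContDiff ℝ 2 u) (hg : ContDiff ℝ 2 g)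
    (hgc : HasCompactSupport g) (v : E) :
    ∫ x, u x * fderiv ℝ (fderiv ℝ g) x v v = ∫ x, fderiv ℝ (fderiv ℝ u) x v v * g x := by
  have hdiff {w : E → ℝ} (hw : ContDiff ℝ 2 w) : ContDiff ℝ 1 fun y => fderiv ℝ w y v :=
    (hw.fderiv_right (by norm_num)).clm_apply contDiff_const
  have happ {w : E → ℝ} (hw : ContDiff ℝ 2 w) (x : E) :
      fderiv ℝ (fderiv ℝ w) x v v = fderiv ℝ (fun y => fderiv ℝ w y v) x v := by
    have := (hw.fderiv_right (m := 1) (by norm_num)).differentiable one_ne_zero x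
    simp [fderiv_clm_apply this (differentiableAt_const v)]
  have hdiff₂ {w : E → ℝ} (hw : ContDiff ℝ 1 w) : Continuous fun y => fderiv ℝ w y v :=
    (hw.continuous_fderiv one_ne_zero).clm_apply continuous_const
  have hint {w h : E → ℝ} (hw : Continuous w) (hh : Continuous h) (hc : HasCompactSupport h) :
      Integrable fun x => w x * h x := (hw.mul hh).integrable_of_hasCompactSupport hc.mul_left
  have hgc' := hgc.fderiv_apply ℝ v
  simp only [happ hu, happ hg]
  rw [integral_mul_fderiv_eq_neg_fderiv_mul_of_integrable
      (hint (hdiff hu).continuous (hdiff hg).continuous hgc')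
      (hint hu.continuous (hdiff₂ (hdiff hg)) (hgc'.fderiv_apply ℝ v))
      (hint hu.continuous (hdiff hg).continuous hgc')
      (fun x _ => hu.differentiable two_ne_zero x)
      (fun x _ => (hdiff hg).differentiable one_ne_zero x),
    integral_mul_fderiv_eq_neg_fderiv_mul_of_integrable
      (hint (hdiff₂ (hdiff hu)) hg.continuous hgc)
      (hint (hdiff hu).continuous (hdiff hg).continuous hgc')
      (hint (hdiff hu).continuous hg.continuous hgc)
      (fun x _ => (hdiff hu).differentiable one_ne_zero x)
      (fun x _ => hg.differentiable two_ne_zero x), neg_neg]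

theorem integral_mul_laplacian_eq {u g : E → ℝ} (hu : ContDiff ℝ 2 u) (hg : ContDiff ℝ 2 g)
    (hgc : HasCompactSupport g) : ∫ x, u x * Δ g x = ∫ x, Δ u x * g x := by
  simp only [laplacian_eq_sum_fderiv_fderiv (stdOrthonormalBasis ℝ E), Finset.mul_sum,
    Finset.sum_mul]
  have hint {w h : E → ℝ} (hw : Continuous w) (hh : Continuous h)
      (hwh : HasCompactSupport fun x => w x * h x) : Integrable fun x => w x * h x :=
    (hw.mul hh).integrable_of_hasCompactSupport hwh
  rw [integral_finsetSum _ fun i _ => hint hu.continuous (continuous_fderiv_fderiv_apply hg _)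
      (hasCompactSupport_fderiv_fderiv_apply hgc _).mul_left,
    integral_finsetSum _ fun i _ => hint (continuous_fderiv_fderiv_apply hu _) hg.continuous
      hgc.mul_left]
  simp only [integral_mul_fderiv_fderiv_eq hu hg hgc]

theorem laplacian_ae_eq_of_tendsto {u : ℕ → E → ℝ} {w h : E → ℝ} {B D : ℝ}
    (hu : ∀ n, ContDiff ℝ 2 (u n)) (hB : ∀ n x, |u n x| ≤ B) (hD : ∀ n x, |Δ (u n) x| ≤ D)
    (hw : ContDiff ℝ 2 w) (hh : LocallyIntegrable h)
    (huw : ∀ᵐ x, Tendsto (fun n => u n x) atTop (𝓝 (w x)))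
    (huh : ∀ᵐ x, Tendsto (fun n => Δ (u n) x) atTop (𝓝 (h x))) : Δ w =ᵐ[volume] h := by
  have hlim {a : ℕ → E → ℝ} {b g : E → ℝ} {C : ℝ} (ha : ∀ n, Continuous (a n))
      (hC : ∀ n x, |a n x| ≤ C) (hab : ∀ᵐ x, Tendsto (fun n => a n x) atTop (𝓝 (b x)))
      (hg : Continuous g) (hgc : HasCompactSupport g) :
      Tendsto (fun n => ∫ x, a n x * g x) atTop (𝓝 (∫ x, b x * g x)) := by
    refine tendsto_integral_of_dominated_convergence (fun x => C * ‖g x‖)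
      (fun n => ((ha n).mul hg).aestronglyMeasurable)
      ((hg.integrable_of_hasCompactSupport hgc).norm.const_mul C)
      (fun n => .of_forall fun x => ?_) (hab.mono fun x hx => hx.mul_const _)
    rw [norm_mul]
    exact mul_le_mul_of_nonneg_right (hC n x) (norm_nonneg _)
  refine ae_eq_of_integral_contDiff_smul_eq (continuous_laplacian hw).locallyIntegrable hh
    fun g hg hgc => ?_
  have hg2 : ContDiff ℝ 2 g := contDiff_infty.1 hg 2
  have hΔ := hlim (fun n => continuous_laplacian (hu n)) hD huh hg.continuous hgc
  simp only [← integral_mul_laplacian_eq (hu _) hg2 hgc] at hΔ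
  have := tendsto_nhds_unique hΔ
    (hlim (fun n => (hu n).continuous) hB huw (continuous_laplacian hg2)
      (hasCompactSupport_laplacian hgc))
  simp only [smul_eq_mul, mul_comm (g _), this, integral_mul_laplacian_eq hw hg2 hgc]

theorem integrable_mul_pow (ψ : 𝓢(E, ℝ)) (l : E →L[ℝ] ℝ) (n : ℕ) :
    Integrable fun x => ψ x * l x ^ n := by
  refine ((ψ.integrable_pow_mul volume n).const_mul (‖l‖ ^ n)).mono'
    (ψ.continuous.mul (l.continuous.pow n)).aestronglyMeasurable (.of_forall fun x => ?_)
  rw [norm_mul, norm_pow, ← mul_assoc, ← mul_pow, mul_comm]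
  gcongr
  exact l.le_opNorm x

theorem integral_lineDerivOp_mul_pow (ψ : 𝓢(E, ℝ)) (l : E →L[ℝ] ℝ) (v : E) (n : ℕ) :
    ∫ x, ∂_{v} ψ x * l x ^ (n + 1) = -((n + 1) * l v) * ∫ x, ψ x * l x ^ n := by
  have hderiv (x : E) : fderiv ℝ (fun x => l x ^ (n + 1)) x v = (n + 1) * l v * l x ^ n := by
    rw [(l.hasFDerivAt.pow (n + 1)).fderiv]
    simp only [add_tsub_cancel_right, nsmul_eq_mul, Nat.cast_add, Nat.cast_one, smul_apply,
      smul_eq_mul]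
    ring
  have hψ := integrable_mul_pow ψ l
  have hparts := integral_mul_fderiv_eq_neg_fderiv_mul_of_integrable (μ := volume)
    (f := fun x => l x ^ (n + 1)) (g := ψ) (v := v)
    (by simpa only [hderiv, mul_assoc, mul_comm (l _ ^ n)] using
      ((hψ n).const_mul (l v)).const_mul (n + 1 : ℝ))
    (by simpa only [mul_comm, SchwartzMap.lineDerivOp_apply_eq_fderiv] using
      integrable_mul_pow (∂_{v} ψ) l (n + 1))
    (by simpa only [mul_comm] using hψ (n + 1))
    (fun x _ => (l.differentiable.pow (n + 1)) x) (fun x _ => ψ.differentiable x)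
  simp only [hderiv, mul_assoc _ _ (ψ _), mul_comm (l _ ^ _)] at hparts
  rw [integral_const_mul] at hparts
  simpa only [SchwartzMap.lineDerivOp_apply_eq_fderiv, neg_mul] using hparts

theorem integral_lineDerivOp_lineDerivOp_mul_sq (ψ : 𝓢(E, ℝ)) (l : E →L[ℝ] ℝ) (v w : E) :
    ∫ x, ∂_{v} (∂_{w} ψ) x * l x ^ 2 = 2 * (l v * l w) * ∫ x, ψ x := by
  rw [integral_lineDerivOp_mul_pow, integral_lineDerivOp_mul_pow ψ l w 0]
  simp only [Nat.cast_one, CharP.cast_eq_zero, zero_add, one_mul, pow_zero, mul_one, neg_mul,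
    mul_neg, neg_neg]
  ring

variable {ι : Type*} [Fintype ι] {e : OrthonormalBasis ι ℝ E} {f : 𝓢(E, ℝ) →L[ℝ] ℝ}
  {F : ι → ι → E → ℝ} {ψ : 𝓢(E, ℝ)} {a : ℝ}

theorem mul_laplacian_eq_of_tendsto_smear_rescale (hF : ∀ i j, Integrable (F i j))
    (hf : ∀ φ, f (Δ φ) = -hessianPairing e F φ) {s : ℕ → ℝˣ}
    (hs : Tendsto (fun n => (s n : ℝ)) atTop atTop) {B : ℝ}
    (hB : ∀ n x, |smear (rescale (s n) f) ψ x| ≤ B)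
    (hlim : ∀ᵐ x, Tendsto (fun n => smear (rescale (s n) f) ψ x) atTop (𝓝 (a * ψ (-x)))) (x : E) :
    a * Δ ψ x = -∑ i, ∑ j, (∫ y, F i j y) * ∂_{e i} (∂_{e j} ψ) x := by
  obtain ⟨D, hD⟩ := exists_abs_laplacian_smear_rescale_le hF hf ψ
  have hΔ (x : E) : Δ (fun x => a * ψ (-x)) x = a * Δ ψ (-x) := by
    have heq : (fun x => a * ψ (-x)) =
        a • ⇑(dilate (-1) (SchwartzMap.compSubConstCLM ℝ 0 ψ)) := by
      ext x
      simp [dilate_apply]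
    rw [heq, InnerProductSpace.laplacian_smul _ ((SchwartzMap.smooth _ 2).contDiffAt), smul_eq_mul,
      ← SchwartzMap.laplacian_apply, laplacian_dilate_compSubConstCLM]
    simp [dilate_apply]
  have hcont : Continuous fun x => -∑ i, ∑ j, (∫ y, F i j y) * ∂_{e i} (∂_{e j} ψ) (-x) := by
    have (i j : ι) : Continuous fun x => ∂_{e i} (∂_{e j} ψ) (-x) :=
      (SchwartzMap.continuous _).comp continuous_neg
    fun_prop
  have hw : ContDiff ℝ 2 fun x => a * ψ (-x) :=
    contDiff_const.mul ((ψ.smooth 2).comp contDiff_neg)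
  have hae := laplacian_ae_eq_of_tendsto (fun n => contDiff_smear _ _ 2) hB (fun n => hD (s n)) hw
    hcont.locallyIntegrable hlim (.of_forall (tendsto_laplacian_smear_rescale hF hf ψ hs))
  have := congrFun ((continuous_laplacian hw).ae_eq_iff_eq volume hcont |>.1 hae) (-x)
  simpa only [hΔ, neg_neg] using this

theorem integral_diag_eq_neg_of_tendsto_smear_rescale (hF : ∀ i j, Integrable (F i j))
    (hf : ∀ φ, f (Δ φ) = -hessianPairing e F φ) (hψ : ∫ x, ψ x ≠ 0) {s : ℕ → ℝˣ}
    (hs : Tendsto (fun n => (s n : ℝ)) atTop atTop) {B : ℝ}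
    (hB : ∀ n x, |smear (rescale (s n) f) ψ x| ≤ B)
    (hlim : ∀ᵐ x, Tendsto (fun n => smear (rescale (s n) f) ψ x) atTop (𝓝 (a * ψ (-x)))) (k : ι) :
    ∫ x, F k k x = -a := by
  classical
  have heq := mul_laplacian_eq_of_tendsto_smear_rescale hF hf hs hB hlim
  let l : E →L[ℝ] ℝ := innerSL ℝ (e k)
  have hl (i : ι) : l (e i) = if k = i then 1 else 0 := orthonormal_iff_ite.1 e.orthonormal k i
  have hmoment (i j : ι) : ∫ x, ∂_{e i} (∂_{e j} ψ) x * l x ^ 2 =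
      if k = i then if k = j then 2 * ∫ x, ψ x else 0 else 0 := by
    rw [integral_lineDerivOp_lineDerivOp_mul_sq, hl, hl]
    split_ifs <;> simp
  have hint (i j : ι) : Integrable fun x => ∂_{e i} (∂_{e j} ψ) x * l x ^ 2 :=
    integrable_mul_pow _ l 2
  have hleft : ∫ x, a * Δ ψ x * l x ^ 2 = a * (2 * ∫ x, ψ x) := by
    simp only [SchwartzMap.laplacian_eq_sum e, sum_apply, Finset.sum_mul, mul_assoc]
    rw [integral_const_mul, integral_finsetSum _ fun i _ => hint i i]
    simp [hmoment]
  have hright : ∫ x, (-∑ i, ∑ j, (∫ y, F i j y) * ∂_{e i} (∂_{e j} ψ) x) * l x ^ 2 =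
      -((∫ y, F k k y) * (2 * ∫ x, ψ x)) := by
    simp only [neg_mul, Finset.sum_mul, mul_assoc]
    rw [integral_neg, integral_finsetSum _ fun i _ => integrable_finsetSum _ fun j _ =>
      (hint i j).const_mul _]
    simp_rw [integral_finsetSum _ fun j _ => (hint _ j).const_mul _, integral_const_mul, hmoment]
    simp
  simp only [heq, hright] at hleft
  have := mul_right_cancel₀ (mul_ne_zero two_ne_zero hψ) ((neg_mul _ _).trans hleft)
  linarith

end Mass

/-! ### Pressures of integrable and of Hardy type -/

section Bounds

variable {E : Type*} [NormedAddCommGroup E] [InnerProductSpace ℝ E] [FiniteDimensional ℝ E]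
  [Nontrivial E] [MeasurableSpace E] [BorelSpace E] {q D : ℝ}

variable (E) in
theorem exists_abs_le_of_integral_rpow_le (hq : 0 < q) (hq1 : q ≤ 1) (D m : ℝ) :
    ∃ B, ∀ u : E → ℝ, ContDiff ℝ 2 u → (∀ x, |Δ u x| ≤ D) →
      (∀ x, ∫ z in Metric.closedBall x 1, |u z| ^ q ≤ m) → ∀ x, |u x| ≤ B := by
  obtain ⟨C, hC, hbound⟩ := exists_rpow_mul_le_integral_or_abs_le E hq hq1
  refine ⟨max ((C * m) ^ q⁻¹) (C * D), fun u hu hD hm x => le_max_iff.2 ?_⟩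
  refine (hbound u x 1 D hu one_pos fun z _ => hD z).imp (fun hlarge => ?_) (by simp)
  rw [one_pow, one_mul] at hlarge
  have hle : |u x| ^ q ≤ C * m := hlarge.trans (by gcongr; exact hm x)
  exact (Real.le_rpow_inv_iff_of_pos (abs_nonneg _) (hle.trans' (by positivity)) hq).2 hle

theorem tendsto_zero_of_tendsto_integral_rpow (hq : 0 < q) (hq1 : q ≤ 1) {u : ℕ → E → ℝ}
    (hu : ∀ n, ContDiff ℝ 2 (u n)) (hD : ∀ n x, |Δ (u n) x| ≤ D) {x : E} {ρ : ℝ} (hρ : 0 < ρ)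
    (hint : Tendsto (fun n => ∫ z in Metric.closedBall x ρ, |u n z| ^ q) atTop (𝓝 0)) :
    Tendsto (fun n => u n x) atTop (𝓝 0) := by
  obtain ⟨C, hC, hbound⟩ := exists_rpow_mul_le_integral_or_abs_le E hq hq1
  refine Metric.tendsto_nhds.2 fun ε hε => ?_
  have hsmall : Tendsto (fun r : ℝ => C * (D * r ^ 2)) (𝓝[>] 0) (𝓝 0) :=
    (Continuous.tendsto' (by fun_prop) _ _ (by simp)).mono_left nhdsWithin_le_nhds
  obtain ⟨r, hrε, hr0, hrρ⟩ :=
    ((hsmall.eventually_lt_const hε).and (Ioc_mem_nhdsGT hρ)).exists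
  have hlim : Tendsto (fun n => C * ∫ z in Metric.closedBall x ρ, |u n z| ^ q) atTop (𝓝 0) := by
    simpa using hint.const_mul C
  have hpos : 0 < r ^ Module.finrank ℝ E * ε ^ q := by positivity
  filter_upwards [hlim.eventually_lt_const hpos] with n hn
  rw [Real.dist_0_eq_abs]
  rcases hbound (u n) x r D (hu n) hr0 (fun z _ => hD n z) with hlarge | hle
  · have hmono : ∫ z in Metric.closedBall x r, |u n z| ^ q ≤
        ∫ z in Metric.closedBall x ρ, |u n z| ^ q := by
      have huq : Continuous fun z => |u n z| ^ q := by
        have := (hu n).continuous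
        fun_prop (disch := exact hq.le)
      exact setIntegral_mono_set (huq.continuousOn.integrableOn_compact (isCompact_closedBall _ _))
        (.of_forall fun z => by positivity) (Metric.closedBall_subset_closedBall hrρ).eventuallyLE
    have hlt := (hlarge.trans (by gcongr)).trans_lt hn
    exact (Real.rpow_lt_rpow_iff (abs_nonneg _) hε.le hq).1
      (lt_of_mul_lt_mul_left hlt (by positivity))
  · exact hle.trans_lt hrε

end Bounds

section Maximal

variable {E : Type*} [NormedAddCommGroup E] [InnerProductSpace ℝ E] [FiniteDimensional ℝ E]
  [MeasurableSpace E] [BorelSpace E]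

theorem setIntegral_abs_rpow_le_toReal {q : ℝ} (hq : 0 ≤ q) {u : E → ℝ} (hu : Continuous u)
    {A : Set E} {m : ℝ≥0∞} (hm : m ≠ ⊤) (h : ∫⁻ x in A, ENNReal.ofReal |u x| ^ q ≤ m) :
    ∫ x in A, |u x| ^ q ≤ m.toReal := by
  have huq : Continuous fun z => |u z| ^ q := by fun_prop (disch := exact hq)
  rw [integral_eq_lintegral_of_nonneg_ae (.of_forall fun x => by positivity)
    huq.aestronglyMeasurable]
  refine ENNReal.toReal_mono hm ?_
  simpa only [ENNReal.ofReal_rpow_of_nonneg (abs_nonneg _) hq] using h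

theorem tendsto_setLIntegral_norm_gt {g : E → ℝ≥0∞} (hg : ∫⁻ x, g x ≠ ⊤) :
    Tendsto (fun r : ℝ => ∫⁻ x in {x | r < ‖x‖}, g x) atTop (𝓝 0) := by
  have := isFiniteMeasure_withDensity hg
  have htight := tendsto_measure_norm_gt_of_isTightMeasureSet
    (isTightMeasureSet_singleton (μ := volume.withDensity g))
  simpa only [mem_singleton_iff, iSup_iSup_eq_left,
    withDensity_apply g (measurableSet_lt measurable_const measurable_norm)] using htight

/-- If `|u(x)| ≤ s^d M(s x)` with `s ≥ 1`, the scaling factor is harmless in `L^q` since `q ≤ 1`. -/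
theorem setLIntegral_rpow_le_of_le_pow_mul_comp_smul {q : ℝ} (hq : 0 ≤ q) (hq1 : q ≤ 1) {s : ℝ}
    (hs : 1 ≤ s) {u M : E → ℝ≥0∞}
    (huM : ∀ x, u x ≤ ENNReal.ofReal (s ^ Module.finrank ℝ E) * M (s • x)) (A : Set E) :
    ∫⁻ x in (s • ·) ⁻¹' A, u x ^ q ≤ ∫⁻ y in A, M y ^ q := by
  have hs0 : 0 < s := one_pos.trans_le hs
  set K := ENNReal.ofReal (s ^ Module.finrank ℝ E)
  have hK : K ^ q ≤ K := by
    have hK1 : 1 ≤ K := ENNReal.one_le_ofReal.2 (one_le_pow₀ hs)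
    simpa using ENNReal.rpow_le_rpow_of_exponent_le hK1 hq1
  have hemb : MeasurableEmbedding fun x : E => s • x :=
    (Homeomorph.smulOfNeZero s hs0.ne').measurableEmbedding
  calc ∫⁻ x in (s • ·) ⁻¹' A, u x ^ q
      ≤ ∫⁻ x in (s • ·) ⁻¹' A, K * M (s • x) ^ q := by
        refine lintegral_mono fun x => ?_
        grw [huM x, ENNReal.mul_rpow_of_nonneg _ _ hq, hK]
    _ = K * ∫⁻ y in A, M y ^ q ∂(volume.map (s • ·)) := by
        rw [lintegral_const_mul' _ _ ENNReal.ofReal_ne_top, hemb.restrict_map, hemb.lintegral_map]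
    _ = ∫⁻ y in A, M y ^ q := by
        rw [Measure.map_addHaar_smul _ hs0.ne', Measure.restrict_smul, lintegral_smul_measure,
          smul_eq_mul, ← mul_assoc, abs_of_nonneg (by positivity),
          ← ENNReal.ofReal_mul (by positivity), mul_inv_cancel₀ (by positivity),
          ENNReal.ofReal_one, one_mul]

end Maximal

section Pressure

variable {E : Type*} [NormedAddCommGroup E] [InnerProductSpace ℝ E] [FiniteDimensional ℝ E]
  [MeasurableSpace E] [BorelSpace E]

/-- The scales `s = n + 1` along which distributions are rescaled. -/
def natScale (n : ℕ) : ℝˣ := Units.mk0 (n + 1) (Nat.cast_add_one_ne_zero n)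

theorem one_le_natScale (n : ℕ) : 1 ≤ (natScale n : ℝ) := by
  simp [natScale]

theorem tendsto_natScale : Tendsto (fun n => (natScale n : ℝ)) atTop atTop :=
  tendsto_atTop_add_const_right _ 1 tendsto_natCast_atTop_atTop

variable {ι : Type*} [Fintype ι] {e : OrthonormalBasis ι ℝ E} {F : ι → ι → E → ℝ}

theorem integral_diag_eq_neg_integral (hF : ∀ i j, Integrable (F i j)) {f : 𝓢(E, ℝ) →L[ℝ] ℝ}
    (hf : ∀ φ, f (Δ φ) = -hessianPairing e F φ) {g : E → ℝ} (hg : Integrable g)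
    (hfg : ∀ φ, f φ = ∫ x, g x * φ x) {ψ : 𝓢(E, ℝ)} (hψ : ∫ x, ψ x ≠ 0) (k : ι) :
    ∫ x, F k k x = -∫ x, g x := by
  have hsmear (n : ℕ) (x : E) : smear (rescale (natScale n) f) ψ x =
      ∫ y, g y * ψ ((natScale n : ℝ)⁻¹ • y - x) := by
    simp only [smear_rescale_apply, hfg, dilate_apply, SchwartzMap.compSubConstCLM_apply,
      Units.val_inv_eq_inv_val]
  refine integral_diag_eq_neg_of_tendsto_smear_rescale hF hf hψ tendsto_natScale
    (B := (∫ x, ‖g x‖) * SchwartzMap.seminorm ℝ 0 0 ψ) (fun n x => ?_) (.of_forall fun x => ?_) k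
  · rw [hsmear]
    exact norm_integral_mul_le hg fun y => SchwartzMap.norm_le_seminorm ℝ ψ _
  · simp only [hsmear]
    exact tendsto_integral_mul_comp_smul_sub hg ψ (tendsto_inv_atTop_zero.comp tendsto_natScale) x

end Pressure

section Hardy

variable {N : ℕ} {η : 𝓢(Sp N, ℝ)} {f : Distr N} {q : ℝ}

theorem lintegral_maximalFn_rpow_ne_top (hq : 0 < q) (hf : hardyNorm η q f < ⊤) :
    ∫⁻ x, maximalFn η f x ^ q ≠ ⊤ :=
  ((ENNReal.rpow_lt_top_iff_of_pos (one_div_pos.2 hq)).1 hf).ne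

theorem ofReal_abs_smear_rescale_le (η : 𝓢(Sp N, ℝ)) (f : Distr N) {s : ℝˣ} (hs : 0 < (s : ℝ))
    (x : Sp N) : ENNReal.ofReal |smear (rescale s f) (dilate (-1) η) x| ≤
      ENNReal.ofReal ((s : ℝ) ^ N) * maximalFn η f ((s : ℝ) • x) := by
  have hkernel : dilate s⁻¹ (SchwartzMap.compSubConstCLM ℝ x (dilate (-1) η)) =
      (s : ℝ) ^ N • kernelS η s hs ((s : ℝ) • x) := by
    ext y
    have hy : (s : ℝ)⁻¹ • ((s : ℝ) • x - y) = x - (s : ℝ)⁻¹ • y := by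
      rw [smul_sub, inv_smul_smul₀ hs.ne']
    rw [smul_apply, kernelS_apply, smul_eq_mul, mul_inv_cancel_left₀ (by positivity), hy]
    simp [dilate_apply]
  rw [smear_rescale_apply, hkernel, map_smul, smul_eq_mul, abs_mul, abs_of_nonneg (by positivity),
    ENNReal.ofReal_mul (by positivity)]
  gcongr
  exact le_iSup₂_of_le (s : ℝ) hs le_rfl

theorem setIntegral_abs_smear_rescale_rpow_le (hq : 0 < q) (hq1 : q ≤ 1)
    (hf : hardyNorm η q f < ⊤) {s : ℝˣ} (hs : 1 ≤ (s : ℝ)) {A B : Set (Sp N)}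
    (hAB : B ⊆ ((s : ℝ) • ·) ⁻¹' A) :
    ∫ x in B, |smear (rescale s f) (dilate (-1) η) x| ^ q ≤
      (∫⁻ y in A, maximalFn η f y ^ q).toReal := by
  have hA : ∫⁻ y in A, maximalFn η f y ^ q ≠ ⊤ :=
    ((setLIntegral_le_lintegral _ _).trans_lt (lintegral_maximalFn_rpow_ne_top hq hf).lt_top).ne
  refine setIntegral_abs_rpow_le_toReal hq.le (contDiff_smear _ _ 0).continuous hA ?_
  refine (lintegral_mono_set hAB).trans
    (setLIntegral_rpow_le_of_le_pow_mul_comp_smul hq.le hq1 hs (fun x => ?_) A)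
  rw [finrank_euclideanSpace_fin]
  exact ofReal_abs_smear_rescale_le η f (one_pos.trans_le hs) x

theorem tendsto_integral_closedBall_smear_rescale (hq : 0 < q) (hq1 : q ≤ 1)
    (hf : hardyNorm η q f < ⊤) {x : Sp N} (hx : x ≠ 0) :
    Tendsto (fun n => ∫ z in Metric.closedBall x (‖x‖ / 2),
      |smear (rescale (natScale n) f) (dilate (-1) η) z| ^ q) atTop (𝓝 0) := by
  have hx0 : 0 < ‖x‖ := norm_pos_iff.2 hx
  have htail : Tendsto (fun n => (∫⁻ y in {y | natScale n * (‖x‖ / 3) < ‖y‖},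
      maximalFn η f y ^ q).toReal) atTop (𝓝 0) :=
    (ENNReal.tendsto_toReal ENNReal.zero_ne_top).comp <|
      (tendsto_setLIntegral_norm_gt (lintegral_maximalFn_rpow_ne_top hq hf)).comp <|
        tendsto_natScale.atTop_mul_const (by positivity)
  refine squeeze_zero (fun n => by positivity) (fun n =>
    setIntegral_abs_smear_rescale_rpow_le hq hq1 hf (one_le_natScale n) fun z hz => ?_) htail
  have hs := one_pos.trans_le (one_le_natScale n)
  have hz' : ‖x‖ / 3 < ‖z‖ := by
    have := norm_sub_norm_le x z
    rw [mem_closedBall_iff_norm'] at hz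
    linarith
  simpa only [mem_preimage, mem_ofPred_eq, norm_smul, Real.norm_of_nonneg hs.le] using
    mul_lt_mul_of_pos_left hz' hs

theorem integral_diag_eq_zero_of_hardyNorm_lt_top {F : Fin N → Fin N → Sp N → ℝ}
    (hF : ∀ i j, Integrable (F i j)) {e : OrthonormalBasis (Fin N) ℝ (Sp N)}
    (hfF : ∀ φ, f (Δ φ) = -hessianPairing e F φ) (hη : ∫ x, η x ≠ 0) (hq : 0 < q) (hq1 : q ≤ 1)
    (hf : hardyNorm η q f < ⊤) (k : Fin N) : ∫ x, F k k x = 0 := by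
  have : Nonempty (Fin N) := ⟨k⟩
  have hψ : ∫ x, dilate (-1) η x ≠ 0 := by
    simpa [dilate_apply, integral_neg_eq_self (fun x => η x)] using hη
  obtain ⟨D, hD⟩ := exists_abs_laplacian_smear_rescale_le hF hfF (dilate (-1) η)
  obtain ⟨B, hB⟩ := exists_abs_le_of_integral_rpow_le (Sp N) hq hq1 D
    (∫⁻ y in univ, maximalFn η f y ^ q).toReal
  have hbound (n : ℕ) (x : Sp N) :
      |smear (rescale (natScale n) f) (dilate (-1) η) x| ≤ B :=
    hB _ (contDiff_smear _ _ 2) (hD _) (fun x => setIntegral_abs_smear_rescale_rpow_le hq hq1 hf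
      (one_le_natScale n) (subset_univ _)) x
  have hlim : ∀ᵐ x, Tendsto (fun n => smear (rescale (natScale n) f) (dilate (-1) η) x) atTop
      (𝓝 (0 * dilate (-1) η (-x))) := by
    filter_upwards [volume.ae_ne 0] with x hx
    rw [zero_mul]
    exact tendsto_zero_of_tendsto_integral_rpow hq hq1 (fun n => contDiff_smear _ _ 2)
      (fun n => hD _) (half_pos (norm_pos_iff.2 hx))
      (tendsto_integral_closedBall_smear_rescale hq hq1 hf hx)
  simpa using
    integral_diag_eq_neg_of_tendsto_smear_rescale hF hfF hψ tendsto_natScale hbound hlim k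

end Hardy

/-! ### The magnetohydrodynamic equations -/

variable {N : ℕ}

section Gradient

variable {ψ : 𝓢(Sp N, ℝ)}

theorem gradient_apply_eq_lineDerivOp (ψ : 𝓢(Sp N, ℝ)) (x : Sp N) (j : Fin N) :
    gradient ψ x j = ∂_{EuclideanSpace.single j (1 : ℝ)} ψ x := by
  have h := EuclideanSpace.inner_single_right (𝕜 := ℝ) j 1 (gradient ψ x)
  rw [inner_gradient_left] at h
  simpa [SchwartzMap.lineDerivOp_apply_eq_fderiv] using h.symm

theorem isSpaceTest_gradient (hψ : HasCompactSupport ψ) : IsSpaceTest (gradient ψ) where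
  contDiff :=
    (InnerProductSpace.toDual ℝ (Sp N)).symm.contDiff.comp ((ψ.smooth ⊤).fderiv_right (by simp))
  compact := (hψ.fderiv (𝕜 := ℝ)).comp_left (g := (InnerProductSpace.toDual ℝ (Sp N)).symm)
    (map_zero _)

theorem proj_comp_gradient (ψ : 𝓢(Sp N, ℝ)) (j : Fin N) :
    (EuclideanSpace.proj j : Sp N →L[ℝ] ℝ) ∘ gradient ψ =
      ⇑(∂_{EuclideanSpace.single j (1 : ℝ)} ψ : 𝓢(Sp N, ℝ)) :=
  funext fun x => gradient_apply_eq_lineDerivOp ψ x j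

theorem pd_gradient (hψ : HasCompactSupport ψ) (i j : Fin N) (x : Sp N) :
    pd i j (gradient ψ) x =
      ∂_{EuclideanSpace.single i (1 : ℝ)} (∂_{EuclideanSpace.single j (1 : ℝ)} ψ) x := by
  have hd : DifferentiableAt ℝ (gradient ψ) x :=
    (isSpaceTest_gradient hψ).contDiff.differentiable (by simp) x
  rw [SchwartzMap.lineDerivOp_apply_eq_fderiv, ← proj_comp_gradient,
    ((EuclideanSpace.proj j : Sp N →L[ℝ] ℝ).hasFDerivAt.comp x hd.hasFDerivAt).fderiv]
  rfl

theorem divg_gradient (hψ : HasCompactSupport ψ) (x : Sp N) : divg (gradient ψ) x = Δ ψ x := by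
  simp [divg, pd_gradient hψ, SchwartzMap.laplacian_eq_sum (EuclideanSpace.basisFun (Fin N) ℝ)]

theorem divS_gradient (hψ : HasCompactSupport ψ) : divS (isSpaceTest_gradient hψ) = Δ ψ := by
  ext x
  exact divg_gradient hψ x

theorem laplacian_gradient (hψ : HasCompactSupport ψ) :
    Δ (gradient ψ) = gradient (Δ ψ : 𝓢(Sp N, ℝ)) := by
  ext x j
  have hc : ContDiffAt ℝ 2 (gradient ψ) x :=
    (contDiff_infty.1 (isSpaceTest_gradient hψ).contDiff 2).contDiffAt
  have hcomm : Δ (∂_{EuclideanSpace.single j (1 : ℝ)} ψ) =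
      ∂_{EuclideanSpace.single j (1 : ℝ)} (Δ ψ) := by
    simp only [SchwartzMap.laplacian_eq_sum (EuclideanSpace.basisFun (Fin N) ℝ), lineDerivOp_sum,
      lineDerivOp_comm _ _ (EuclideanSpace.single j (1 : ℝ))]
  calc Δ (gradient ψ) x j = Δ ((EuclideanSpace.proj j : Sp N →L[ℝ] ℝ) ∘ gradient ψ) x :=
        (hc.laplacian_CLM_comp_left (l := (EuclideanSpace.proj j : Sp N →L[ℝ] ℝ))).symm
    _ = gradient (Δ ψ : 𝓢(Sp N, ℝ)) x j := by
        rw [proj_comp_gradient, ← SchwartzMap.laplacian_apply, hcomm,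
          gradient_apply_eq_lineDerivOp]

end Gradient

section Stress

variable {v b : Sp N → Sp N}

/-- The matrix `v ⊗ v - b ⊗ b + ½ |b|² I`, whose double divergence is `-Δp`. -/
def stress (v b : Sp N → Sp N) (i j : Fin N) (x : Sp N) : ℝ :=
  v x i * v x j - b x i * b x j + if i = j then 1 / 2 * ‖b x‖ ^ 2 else 0

theorem sum_stress_mul_pd (v b φ : Sp N → Sp N) (x : Sp N) :
    ∑ i, ∑ j, stress v b i j x * pd i j φ x =
      ∑ i, ∑ j, v x i * v x j * pd i j φ x - ∑ i, ∑ j, b x i * b x j * pd i j φ x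
        + 1 / 2 * (‖b x‖ ^ 2 * divg φ x) := by
  simp only [stress, add_mul, sub_mul, ite_mul, zero_mul, Finset.sum_add_distrib,
    Finset.sum_sub_distrib, Finset.sum_ite_eq, Finset.mem_univ, if_true, divg, Finset.mul_sum,
    mul_assoc]

theorem memLp_coord (hv : MemLp v 2) (i : Fin N) : MemLp (fun x => v x i) 2 :=
  (EuclideanSpace.proj i : Sp N →L[ℝ] ℝ).comp_memLp' hv

theorem integrable_coord_mul_coord (hv : MemLp v 2) (i j : Fin N) :
    Integrable fun x => v x i * v x j :=
  (memLp_coord hv i).integrable_mul (memLp_coord hv j)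

theorem integrable_norm_sq (hv : MemLp v 2) : Integrable fun x => ‖v x‖ ^ 2 :=
  hv.integrable_norm_pow two_ne_zero

theorem integrable_stress (hv : MemLp v 2) (hb : MemLp b 2) (i j : Fin N) :
    Integrable (stress v b i j) := by
  refine ((integrable_coord_mul_coord hv i j).sub (integrable_coord_mul_coord hb i j)).add ?_
  split_ifs
  · exact (integrable_norm_sq hb).const_mul _
  · exact integrable_zero _ _ _

theorem integrable_mul_pd_gradient {F : Sp N → ℝ} (hF : Integrable F) {ψ : 𝓢(Sp N, ℝ)}
    (hψ : HasCompactSupport ψ) (i j : Fin N) :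
    Integrable fun x => F x * pd i j (gradient ψ) x := by
  simpa only [pd_gradient hψ] using integrable_mul_schwartz hF _

theorem hessianPairing_eq_integral_mul_pd_gradient {F : Fin N → Fin N → Sp N → ℝ}
    (hF : ∀ i j, Integrable (F i j)) {ψ : 𝓢(Sp N, ℝ)} (hψ : HasCompactSupport ψ) :
    hessianPairing (EuclideanSpace.basisFun (Fin N) ℝ) F ψ =
      ∫ x, ∑ i, ∑ j, F i j x * pd i j (gradient ψ) x := by
  have hint (i j : Fin N) := integrable_mul_pd_gradient (hF i j) hψ i j
  rw [integral_finsetSum _ fun i _ => integrable_finsetSum _ fun j _ => hint i j]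
  refine Finset.sum_congr rfl fun i _ => ?_
  rw [integral_finsetSum _ fun j _ => hint i j]
  simp only [pd_gradient hψ, EuclideanSpace.basisFun_apply]

theorem hessianPairing_stress {v b : ℝ → Sp N → Sp N} {t : ℝ} (hv : MemLp (v t) 2)
    (hb : MemLp (b t) 2) {ψ : 𝓢(Sp N, ℝ)} (hψ : HasCompactSupport ψ) :
    hessianPairing (EuclideanSpace.basisFun (Fin N) ℝ) (stress (v t) (b t)) ψ =
      tens v v (gradient ψ) t - tens b b (gradient ψ) t + 1 / 2 * magn b (gradient ψ) t := by
  have htens {u : ℝ → Sp N → Sp N} (hu : MemLp (u t) 2) :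
      Integrable fun x => ∑ i, ∑ j, u t x i * u t x j * pd i j (gradient ψ) x :=
    integrable_finsetSum _ fun i _ => integrable_finsetSum _ fun j _ =>
      integrable_mul_pd_gradient (integrable_coord_mul_coord hu i j) hψ i j
  have hmagn : Integrable fun x => ‖b t x‖ ^ 2 * divg (gradient ψ) x := by
    simpa only [divg_gradient hψ] using integrable_mul_schwartz (integrable_norm_sq hb) _
  rw [hessianPairing_eq_integral_mul_pd_gradient (integrable_stress hv hb) hψ]
  simp only [sum_stress_mul_pd]
  refine (integral_add ((htens hv).sub (htens hb)) (hmagn.const_mul (1 / 2))).trans ?_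
  rw [integral_sub' (htens hv) (htens hb), integral_const_mul]
  rfl

theorem integral_norm_sq_eq_sum (hv : MemLp v 2) : ∫ x, ‖v x‖ ^ 2 = ∑ i, ∫ x, (v x i) ^ 2 := by
  rw [← integral_finsetSum _ fun i _ => (memLp_coord hv i).integrable_sq]
  simp only [EuclideanSpace.norm_sq_eq, Real.norm_eq_abs, sq_abs]

theorem ae_eq_zero_of_integral_norm_sq (hv : MemLp v 2) (h : ∫ x, ‖v x‖ ^ 2 = 0) :
    ∀ᵐ x, v x = 0 := by
  rw [integral_eq_zero_iff_of_nonneg (fun x => by positivity) (integrable_norm_sq hv)] at h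
  filter_upwards [h] with x hx
  simpa using hx

theorem integral_stress_diag (hv : MemLp v 2) (hb : MemLp b 2) (k : Fin N) :
    ∫ x, stress v b k k x =
      (∫ x, (v x k) ^ 2) - (∫ x, (b x k) ^ 2) + 1 / 2 * ∫ x, ‖b x‖ ^ 2 := by
  have hv2 := (memLp_coord hv k).integrable_sq
  have hb2 := (memLp_coord hb k).integrable_sq
  simp only [stress, if_true, ← sq]
  refine (integral_add (hv2.sub hb2) ((integrable_norm_sq hb).const_mul (1 / 2))).trans ?_
  rw [integral_sub' hv2 hb2, integral_const_mul]

theorem sum_integral_stress_diag (hv : MemLp v 2) (hb : MemLp b 2) :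
    ∑ k, ∫ x, stress v b k k x =
      (∫ x, ‖v x‖ ^ 2) + ((N : ℝ) / 2 - 1) * ∫ x, ‖b x‖ ^ 2 := by
  simp only [integral_stress_diag hv hb, Finset.sum_add_distrib, Finset.sum_sub_distrib,
    ← integral_norm_sq_eq_sum hv, ← integral_norm_sq_eq_sum hb, Finset.sum_const,
    Finset.card_univ, Fintype.card_fin, nsmul_eq_mul]
  ring

theorem eq_zero_of_integral_stress_diag (hN : 2 ≤ N) (hv : MemLp v 2) (hb : MemLp b 2) {c : ℝ}
    (hc : 0 ≤ c) (h : ∀ k, ∫ x, stress v b k k x = -c) :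
    (∀ᵐ x, v x = 0) ∧ (3 ≤ N → ∀ᵐ x, b x = 0) ∧
      ∀ i j, ∫ x, (b x i) ^ 2 = ∫ x, (b x j) ^ 2 := by
  have hV : 0 ≤ ∫ x, ‖v x‖ ^ 2 := by positivity
  have hB : 0 ≤ ∫ x, ‖b x‖ ^ 2 := by positivity
  have hN' : 0 ≤ (N : ℝ) / 2 - 1 := by
    have : (2 : ℝ) ≤ N := mod_cast hN
    linarith
  have hNB := mul_nonneg hN' hB
  have hNc : 0 ≤ N * c := by positivity
  have htrace : (∫ x, ‖v x‖ ^ 2) + ((N : ℝ) / 2 - 1) * ∫ x, ‖b x‖ ^ 2 = -(N * c) := by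
    simp [← sum_integral_stress_diag hv hb, h]
  have hv0 : ∀ᵐ x, v x = 0 := ae_eq_zero_of_integral_norm_sq hv (by linarith)
  refine ⟨hv0, fun h3 => ae_eq_zero_of_integral_norm_sq hb ?_, fun i j => ?_⟩
  · have h3' : (0 : ℝ) < N / 2 - 1 := by
      have : (3 : ℝ) ≤ N := mod_cast h3
      linarith
    exact (mul_eq_zero_iff_left h3'.ne').1 (by linarith)
  · have hvk (k : Fin N) : ∫ x, (v x k) ^ 2 = 0 := integral_eq_zero_of_ae <| by
      filter_upwards [hv0] with x hx
      simp [hx]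
    have hi := integral_stress_diag hv hb i
    have hj := integral_stress_diag hv hb j
    rw [h, hvk] at hi hj
    linarith

end Stress

section PressureEquation

variable {μ ν T : ℝ} {v b : ℝ → Sp N → Sp N} {p : ℝ → Distr N}

theorem IsTimeTest.integrableOn_mul {ξ : ℝ → ℝ} (hξ : IsTimeTest T ξ) {h : ℝ → ℝ}
    (hh : IntegrableOn h (Ioo 0 T)) : IntegrableOn (fun t => h t * ξ t) (Ioo 0 T) := by
  obtain ⟨C, hC⟩ := hξ.contDiff.continuous.bounded_above_of_compact_support hξ.compact
  exact hh.mul_bdd hξ.contDiff.continuous.aestronglyMeasurable (.of_forall hC)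

theorem isTimeTest_contDiffBump {t : ℝ} (ξ : ContDiffBump t)
    (h : Metric.closedBall t ξ.rOut ⊆ Ioo 0 T) : IsTimeTest T ξ where
  contDiff := ξ.contDiff
  compact := ξ.hasCompactSupport
  supp := by rwa [ξ.tsupport_eq]

theorem locallyIntegrableOn_of_integrableOn_mul_timeTest {h : ℝ → ℝ}
    (hh : ∀ ξ, IsTimeTest T ξ → IntegrableOn (fun t => h t * ξ t) (Ioo 0 T)) :
    LocallyIntegrableOn h (Ioo 0 T) := by
  intro t ht
  obtain ⟨ε, hε, hεs⟩ := Metric.isOpen_iff.1 isOpen_Ioo t ht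
  let ξ : ContDiffBump t := ⟨ε / 4, ε / 2, by positivity, by linarith⟩
  have hξ : IsTimeTest T ξ := isTimeTest_contDiffBump ξ <|
    (Metric.closedBall_subset_ball (half_lt_self hε)).trans hεs
  have hsub : Metric.ball t (ε / 4) ⊆ Ioo 0 T :=
    (Metric.ball_subset_ball (by linarith)).trans hεs
  refine ⟨Metric.ball t (ε / 4),
    mem_nhdsWithin_of_mem_nhds (Metric.ball_mem_nhds t (by positivity)), ?_⟩
  refine ((hh ξ hξ).mono_set hsub).congr_fun (fun s hs => ?_) measurableSet_ball
  simp [ξ.one_of_mem_closedBall (Metric.ball_subset_closedBall hs)]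

theorem ae_eq_zero_of_integral_mul_timeTest {h : ℝ → ℝ}
    (hh : ∀ ξ, IsTimeTest T ξ → IntegrableOn (fun t => h t * ξ t) (Ioo 0 T))
    (h0 : ∀ ξ, IsTimeTest T ξ → ∫ t in Ioo 0 T, h t * ξ t = 0) :
    ∀ᵐ t ∂(volume.restrict (Ioo 0 T)), h t = 0 := by
  rw [ae_restrict_iff' measurableSet_Ioo]
  refine isOpen_Ioo.ae_eq_zero_of_integral_contDiff_smul_eq_zero
    (locallyIntegrableOn_of_integrableOn_mul_timeTest hh) fun ξ hξ hξc hξs => ?_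
  have hξT : IsTimeTest T ξ := ⟨hξ.of_le (by exact_mod_cast le_top), hξc, hξs⟩
  rw [← h0 ξ hξT, setIntegral_eq_integral_of_forall_compl_eq_zero fun t ht => by
    rw [image_eq_zero_of_notMem_tsupport fun h => ht (hξs h), mul_zero]]
  simp only [smul_eq_mul, mul_comm]

theorem MemL1L2σ.ae_pair_gradient_eq_zero {u : ℝ → Sp N → Sp N} (hu : MemL1L2σ T u)
    {ψ : 𝓢(Sp N, ℝ)} (hψ : HasCompactSupport ψ) :
    ∀ᵐ t ∂(volume.restrict (Ioo 0 T)), pair u (gradient ψ) t = 0 := by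
  filter_upwards [hu.div_free] with t ht
  exact ht ψ (ψ.smooth ⊤) hψ

theorem IsWeakSolution.momentum_gradient (hsol : IsWeakSolution μ ν T v b p) {ψ : 𝓢(Sp N, ℝ)}
    (hψ : HasCompactSupport ψ) {ξ : ℝ → ℝ} (hξ : IsTimeTest T ξ) :
    (∫ t in Ioo 0 T, tens v v (gradient ψ) t * ξ t) -
        (∫ t in Ioo 0 T, tens b b (gradient ψ) t * ξ t) +
        (∫ t in Ioo 0 T, p t (Δ ψ) * ξ t) +
        1 / 2 * (∫ t in Ioo 0 T, magn b (gradient ψ) t * ξ t) = 0 := by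
  have hΔψ : HasCompactSupport (Δ ψ : 𝓢(Sp N, ℝ)) := by
    simpa only [← funext (SchwartzMap.laplacian_apply ψ)] using! hasCompactSupport_laplacian hψ
  have htime : ∫ t in Ioo 0 T, pair v (gradient ψ) t * deriv ξ t = 0 :=
    integral_eq_zero_of_ae <| by
      filter_upwards [hsol.mem_v.ae_pair_gradient_eq_zero hψ] with t ht
      simp [ht]
  have hvisc : ∫ t in Ioo 0 T, pair v (Δ (gradient ψ)) t * ξ t = 0 :=
    integral_eq_zero_of_ae <| by
      filter_upwards [hsol.mem_v.ae_pair_gradient_eq_zero hΔψ] with t ht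
      simp [laplacian_gradient hψ, ht]
  have h := hsol.momentum _ ξ (isSpaceTest_gradient hψ) hξ
  rw [htime, hvisc, divS_gradient hψ] at h
  linarith

theorem IsWeakSolution.ae_apply_laplacian_of_hasCompactSupport (hsol : IsWeakSolution μ ν T v b p)
    {ψ : 𝓢(Sp N, ℝ)} (hψ : HasCompactSupport ψ) :
    ∀ᵐ t ∂(volume.restrict (Ioo 0 T)), p t (Δ ψ) =
      -hessianPairing (EuclideanSpace.basisFun (Fin N) ℝ) (stress (v t) (b t)) ψ := by
  set φ := gradient ψ
  have hφ : IsSpaceTest φ := isSpaceTest_gradient hψ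
  have hvv ξ (hξ : IsTimeTest T ξ) := hsol.int_vv φ ξ hφ hξ
  have hbb ξ (hξ : IsTimeTest T ξ) := hsol.int_bb φ ξ hφ hξ
  have hpΔ ξ (hξ : IsTimeTest T ξ) := hξ.integrableOn_mul (hsol.mem_p (Δ ψ))
  have hbd ξ (hξ : IsTimeTest T ξ) := (hsol.int_magn φ ξ hφ hξ).const_mul (1 / 2)
  have hsum : ∀ᵐ t ∂(volume.restrict (Ioo 0 T)),
      tens v v φ t - tens b b φ t + p t (Δ ψ) + 1 / 2 * magn b φ t = 0 := by
    refine ae_eq_zero_of_integral_mul_timeTest (fun ξ hξ => ?_) fun ξ hξ => ?_ <;>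
      simp only [add_mul, sub_mul, mul_assoc]
    · exact (((hvv ξ hξ).sub (hbb ξ hξ)).add (hpΔ ξ hξ)).add (hbd ξ hξ)
    · refine (integral_add (((hvv ξ hξ).sub (hbb ξ hξ)).add (hpΔ ξ hξ)) (hbd ξ hξ)).trans ?_
      rw [integral_add' ((hvv ξ hξ).sub (hbb ξ hξ)) (hpΔ ξ hξ),
        integral_sub' (hvv ξ hξ) (hbb ξ hξ), integral_const_mul]
      exact hsol.momentum_gradient hψ hξ
  filter_upwards [hsum, hsol.mem_v.memL2, hsol.mem_b.memL2] with t ht hv hb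
  rw [hessianPairing_stress hv hb hψ]
  linarith

theorem IsWeakSolution.ae_apply_laplacian (hsol : IsWeakSolution μ ν T v b p) :
    ∀ᵐ t ∂(volume.restrict (Ioo 0 T)), ∀ ψ, p t (Δ ψ) =
      -hessianPairing (EuclideanSpace.basisFun (Fin N) ℝ) (stress (v t) (b t)) ψ := by
  obtain ⟨A, hAc, hAs, hA⟩ := exists_countable_dense_hasCompactSupport (E := Sp N)
  have hae := (ae_ball_iff hAc).2 fun ψ hψ =>
    hsol.ae_apply_laplacian_of_hasCompactSupport (hAs ψ hψ)
  filter_upwards [hae, hsol.mem_v.memL2, hsol.mem_b.memL2] with t ht hv hb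
  have hcont : Continuous fun ψ : 𝓢(Sp N, ℝ) => p t (Δ ψ) :=
    (p t).continuous.comp (LineDeriv.laplacianCLM ℝ (Sp N) 𝓢(Sp N, ℝ)).continuous
  exact congrFun <| hcont.ext_on hA
    (continuous_hessianPairing _ (integrable_stress hv hb)).neg ht

end PressureEquation

section Vanishing

variable {μ ν T : ℝ} {v b : ℝ → Sp N → Sp N} {p : ℝ → Distr N}

/-- The hypothesis on the pressure at a single time: it is an integrable function of nonnegative
mass, or it belongs to one of the Hardy spaces `𝓗^q`, `0 < q ≤ 1`. -/
def IsAdmissiblePressure (η : 𝓢(Sp N, ℝ)) (f : Distr N) : Prop :=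
  (∃ g, Integrable g ∧ (∀ ψ, f ψ = ∫ x, g x * ψ x) ∧ 0 ≤ ∫ x, g x) ∨
    ∃ q, 0 < q ∧ q ≤ 1 ∧ hardyNorm η q f < ⊤

theorem MemL1L1Plus.ae_isAdmissiblePressure (η : 𝓢(Sp N, ℝ)) (hp : MemL1L1Plus T p) :
    ∀ᵐ t ∂(volume.restrict (Ioo 0 T)), IsAdmissiblePressure η (p t) := by
  obtain ⟨g, hg, hpg, hg0⟩ := hp
  filter_upwards [hg.prod_right_ae, hpg, hg0] with t h₁ h₂ h₃
  exact .inl ⟨g t, h₁, h₂, h₃⟩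

theorem MemL1Hardy.ae_isAdmissiblePressure {η : 𝓢(Sp N, ℝ)} {q : ℝ} (hq : 0 < q) (hq1 : q ≤ 1)
    (hp : MemL1Hardy η q T p) :
    ∀ᵐ t ∂(volume.restrict (Ioo 0 T)), IsAdmissiblePressure η (p t) :=
  hp.mem.mono fun _ ht => .inr ⟨q, hq, hq1, ht⟩

theorem IsAdmissiblePressure.exists_integral_diag_eq_neg {η : 𝓢(Sp N, ℝ)} {f : Distr N}
    (hf : IsAdmissiblePressure η f) (hη : ∫ x, η x ≠ 0) {F : Fin N → Fin N → Sp N → ℝ}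
    (hF : ∀ i j, Integrable (F i j)) {e : OrthonormalBasis (Fin N) ℝ (Sp N)}
    (hfF : ∀ φ, f (Δ φ) = -hessianPairing e F φ) :
    ∃ c, 0 ≤ c ∧ ∀ k, ∫ x, F k k x = -c := by
  rcases hf with ⟨g, hg, hfg, hg0⟩ | ⟨q, hq, hq1, hH⟩
  · exact ⟨∫ x, g x, hg0, integral_diag_eq_neg_integral hF hfF hg hfg hη⟩
  · refine ⟨0, le_rfl, fun k => ?_⟩
    rw [neg_zero, integral_diag_eq_zero_of_hardyNorm_lt_top hF hfF hη hq hq1 hH]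

theorem ae_prod_eq_zero {α β G : Type*} [MeasurableSpace α] [MeasurableSpace β]
    [NormedAddCommGroup G] {ρ : Measure α} {σ : Measure β} [SFinite σ] {u : α → β → G}
    (hu : AEStronglyMeasurable (Function.uncurry u) (ρ.prod σ))
    (h : ∀ᵐ t ∂ρ, ∀ᵐ x ∂σ, u t x = 0) : ∀ᵐ z ∂(ρ.prod σ), u z.1 z.2 = 0 := by
  have h0 : ∫⁻ z, ‖Function.uncurry u z‖ₑ ∂(ρ.prod σ) = 0 := by
    rw [lintegral_prod _ hu.enorm]
    refine lintegral_eq_zero_of_ae_eq_zero (h.mono fun t ht => ?_)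
    refine lintegral_eq_zero_of_ae_eq_zero (ht.mono fun x hx => ?_)
    simp [Function.uncurry, hx]
  filter_upwards [(lintegral_eq_zero_iff' hu.enorm).1 h0] with z hz
  simpa [Function.uncurry] using hz

theorem tens_eq_zero {u w : ℝ → Sp N → Sp N} {t : ℝ}
    (h : (∀ᵐ x, u t x = 0) ∨ ∀ᵐ x, w t x = 0) (φ : Sp N → Sp N) : tens u w φ t = 0 := by
  refine integral_eq_zero_of_ae ?_
  rcases h with h | h <;> filter_upwards [h] with x hx <;> simp [hx]

theorem IsWeakSolution.isWeakHeatSolution (hsol : IsWeakSolution μ ν T v b p)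
    (hv : ∀ᵐ t ∂(volume.restrict (Ioo 0 T)), ∀ᵐ x, v t x = 0) : IsWeakHeatSolution μ T b where
  mem := hsol.mem_b
  heat φ ξ hφ hξ := by
    have hvb : ∫ t in Ioo 0 T, tens v b φ t * ξ t = 0 := integral_eq_zero_of_ae <| by
      filter_upwards [hv] with t ht
      simp [tens_eq_zero (.inl ht)]
    have hbv : ∫ t in Ioo 0 T, tens b v φ t * ξ t = 0 := integral_eq_zero_of_ae <| by
      filter_upwards [hv] with t ht
      simp [tens_eq_zero (.inr ht)]
    simpa [hvb, hbv] using hsol.induction_eq φ ξ hφ hξ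

end Vanishing

end MHD

end

theorem theorem3p1_general (N : ℕ) (hN : 2 ≤ N) (μ ν T : ℝ)
    (v b : ℝ → MHD.Sp N → MHD.Sp N) (p : ℝ → MHD.Distr N)
    (hsol : MHD.IsWeakSolution μ ν T v b p)
    (η : 𝓢(MHD.Sp N, ℝ)) (hη : (∫ x, η x) ≠ 0)
    (hp : ∀ᵐ t ∂(volume.restrict (Ioo 0 T)), MHD.IsAdmissiblePressure η (p t)) :
    (∀ᵐ z : ℝ × MHD.Sp N ∂((volume.restrict (Ioo 0 T)).prod volume), v z.1 z.2 = 0) ∧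
    (3 ≤ N → ∀ᵐ z : ℝ × MHD.Sp N ∂((volume.restrict (Ioo 0 T)).prod volume), b z.1 z.2 = 0) ∧
    (∀ᵐ t ∂(volume.restrict (Ioo 0 T)), ∀ i j : Fin N,
      (∫ x, (b t x i) ^ 2) = ∫ x, (b t x j) ^ 2) ∧
    MHD.IsWeakHeatSolution μ T b := by
  have hslice : ∀ᵐ t ∂(volume.restrict (Ioo 0 T)), (∀ᵐ x, v t x = 0) ∧
      (3 ≤ N → ∀ᵐ x, b t x = 0) ∧ ∀ i j, ∫ x, (b t x i) ^ 2 = ∫ x, (b t x j) ^ 2 := by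
    filter_upwards [hp, hsol.ae_apply_laplacian, hsol.mem_v.memL2, hsol.mem_b.memL2]
      with t hpt hΔp hv hb
    obtain ⟨c, hc, h⟩ :=
      hpt.exists_integral_diag_eq_neg hη (MHD.integrable_stress hv hb) hΔp
    exact MHD.eq_zero_of_integral_stress_diag hN hv hb hc h
  have hv : ∀ᵐ t ∂(volume.restrict (Ioo 0 T)), ∀ᵐ x, v t x = 0 := hslice.mono fun _ h => h.1
  exact ⟨MHD.ae_prod_eq_zero hsol.mem_v.meas hv,
    fun h3 => MHD.ae_prod_eq_zero hsol.mem_b.meas (hslice.mono fun _ h => h.2.1 h3),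
    hslice.mono fun _ h => h.2.2, hsol.isWeakHeatSolution hv⟩

theorem theorem3p1 (N : ℕ) (hN : 2 ≤ N) (μ ν T : ℝ) (hμ : 0 ≤ μ) (hν : 0 ≤ ν) (hT : 0 < T)
    (v b : ℝ → MHD.Sp N → MHD.Sp N) (p : ℝ → MHD.Distr N)
    (hsol : MHD.IsWeakSolution μ ν T v b p)
    (η : 𝓢(MHD.Sp N, ℝ)) (hη : (∫ x, η x) ≠ 0)
    (hp : MHD.MemL1L1Plus T p ∨ ∃ q : ℝ, 0 < q ∧ q ≤ 1 ∧ MHD.MemL1Hardy η q T p) :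
    (3 ≤ N → ∀ᵐ z : ℝ × MHD.Sp N ∂((volume.restrict (Ioo 0 T)).prod volume),
      v z.1 z.2 = 0 ∧ b z.1 z.2 = 0) ∧
    (N = 2 →
      (∀ᵐ z : ℝ × MHD.Sp N ∂((volume.restrict (Ioo 0 T)).prod volume), v z.1 z.2 = 0) ∧
      (∀ᵐ t ∂(volume.restrict (Ioo 0 T)), ∀ i j : Fin N,
        (∫ x, (b t x i) ^ 2) = ∫ x, (b t x j) ^ 2) ∧
      MHD.IsWeakHeatSolution μ T b) := by
  have hpt : ∀ᵐ t ∂(volume.restrict (Ioo 0 T)), MHD.IsAdmissiblePressure η (p t) := by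
    rcases hp with hp | ⟨q, hq, hq1, hp⟩
    exacts [hp.ae_isAdmissiblePressure η, hp.ae_isAdmissiblePressure hq hq1]
  obtain ⟨hv, hb, hdiag, hheat⟩ := theorem3p1_general N hN μ ν T v b p hsol η hη hpt
  exact ⟨fun h3 => hv.and (hb h3), fun _ => ⟨hv, hdiag, hheat⟩⟩
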